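/- **Conventions.** A *Conway–Coxeter frieze* with $m$ inner lines is an array of positive integers on $m+2$ shifted lines, whose top and bottom lines consist of $1$s, such that $ad-bc=1$ for every unit diamond with left, top, bottom, right entries $a,b,c,d$. It is *of zigzag type* if $m\ge 1$ and some zigzag line of $1$s, going down one line at a time to the left ($L$) or to the right ($R$), runs from the first to the last inner line; if the word read off is $w$ (of length $m-1$), the frieze is generated by $w$. Friezes are considered up to horizontal translation and reflection in a vertical line, in the middle horizontal line, or both. For $\alpha=\frac pq\in\mathbb Q\cap(0,1)$ in lowest terms the *parents* of $\alpha$ are the fractions $\frac xr,\frac ys$ (in lowest terms, with non-negative denominators) with $ry-xs=1$, $x+y=p$, $r+s=q$. Put $i(\alpha)=\frac{q-p}{q}$. The word $w(\alpha)$ is given by $w(\frac12)=\emptyset$, $w(\alpha)=L\,w(\frac ys)$ if $r<s$, and $w(\alpha)=R\,w(\frac xr)$ if $r>s$; $\Gamma_\alpha$ is the frieze generated by $w(\alpha)$. Write $\alpha=[0,a_1,\dots,a_n]$ (continued fraction) with $n$ even and all $a_j\ge1$. $D(T(\alpha))$ is the alternating diagram with four horizontal strands, numbered $1,\dots,4$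 from top to bottom, having from left to right $a_1$ half twists of the strands in positions $2,3$, then $a_2$ half twists of the strands in positions $1,2$, and so on alternately, closed on the left by arcs joining positions $1,2$ and $3,4$ and on the right by arcs joining positions $2,3$ and $1,4$; in the crossings at positions $2,3$ the over-strand rises from left to right, in those at positions $1,2$ it falls. The diagram is oriented; if $q$ is even (two components), the orientation is such that the two strands entering the first twist region from the left have opposite directions. With $\mathrm{wr}(\alpha)$ the writhe and $\langle\ \rangle$ the Kauffman bracket (in $A$, with value $1$ on a circle), let $V(\alpha)=(-A^3)^{-\mathrm{wr}(\alpha)}\langle D(T(\alpha))\rangle\in\mathbb Z[A^{\pm1}]$ be the Jones polynomial, and let the bar denote $A\mapsto A^{-1}$. **Statement.** Every $\alpha\in\mathbb Q\cap(0,1)$ has exactly one pair of parents $\frac xr,\frac ys$, and if $q$ is even then exactly one of $x,y$ is even. Let $\Gamma$ be a Conway–Coxeter frieze of zigzag type. There is a rational $\alpha\in(0,1)$ with $\Gamma=\Gamma_\alpha$ (up to the above identification of friezes), and the class of mutually identified polynomials $$V(\Gamma):=\begin{cases}\{V(\alpha),\ \overline{V(\alpha)}\} & \text{if } q \text{ is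 odd},\\ \{V(\alpha),\ V(i(\alpha))\} & \text{if } q \text{ and } x \text{ are even},\\ \{V(\alpha),\ V(i(\alpha)),\ \overline{V(i(\alpha))},\ \overline{V(\alpha)}\} & \text{if } q \text{ and } y \text{ are even}\end{cases}$$ is well-defined: it is the same for all $\alpha=\frac pq\in(0,1)$ with $\Gamma=\Gamma_\alpha$. Moreover it is a class of Laurent polynomials in $t^{1/2}$: there is exactly one set of Laurent polynomials in $t^{1/2}$ with integer coefficients that becomes $V(\Gamma)$ under the substitution $t=A^{-4}$, i.e. $t^{1/2}=A^{-2}$ (the Jones polynomial of $\Gamma$). -/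

import Mathlib

open scoped LaurentPolynomial

/-! ### Parents of a rational number, and continued fractions -/

/-- `x / r` and `y / s` are the parents of `α`: they are Farey neighbours (`r * y - x * s = 1`) and
`α` is their mediant `(x + y) / (r + s)`, all fractions being written in lowest terms. -/
def IsParents (α : ℚ) (x r y s : ℕ) : Prop :=
  r * y = x * s + 1 ∧ α.num = x + y ∧ α.den = r + s

/-- The value of the continued fraction `[0, a₁, …, aₙ]`. -/
def cfValue : List ℕ → ℚ
  | [] => 0
  | a :: l => 1 / (a + cfValue l)

/-- `α = [0, a₁, …, aₙ]` with `n` even and `a₁, …, aₙ` positive. -/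
def IsEvenExpansion (α : ℚ) (l : List ℕ) : Prop :=
  Even l.length ∧ (∀ a ∈ l, 0 < a) ∧ cfValue l = α

open Classical in
/-- The digits `a₁, …, aₙ` of the expansion of `α ∈ (0,1)` with `n` even, which exists and is
unique. -/
noncomputable def evenExpansion (α : ℚ) : List ℕ :=
  if h : ∃ l, IsEvenExpansion α l then h.choose else []

/-! ### Words in two letters and Conway–Coxeter friezes -/

/-- The two letters: a step down to the left, and a step down to the right. -/
inductive LR : Type
  | L
  | R

/-- `IsWord α w`: the word of `α ∈ (0,1)` is `w`. -/
inductive IsWord : ℚ → List LR → Prop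
  | half : IsWord (1 / 2) []
  | left {α : ℚ} {x r y s : ℕ} {w : List LR} (h : IsParents α x r y s) (hrs : r < s)
      (hw : IsWord ((y : ℚ) / s) w) : IsWord α (LR.L :: w)
  | right {α : ℚ} {x r y s : ℕ} {w : List LR} (h : IsParents α x r y s) (hrs : s < r)
      (hw : IsWord ((x : ℚ) / r) w) : IsWord α (LR.R :: w)

/-- A Conway–Coxeter frieze with `m` lines between the top and the bottom line of `1`s. The lines are
numbered `0, …, m + 1` from the top, and line `k` is shifted to the right by `k` half units: the
entry `entry i k` stands at the horizontal position `i + k / 2`. So the unit diamonds are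
```
                    entry (i + 1) k
  entry i (k + 1)                     entry (i + 1) (k + 1)
                    entry i (k + 2)
```
The values `entry i k` with `k > m + 1` are not part of the frieze and carry no meaning. -/
structure CCFrieze (m : ℕ) where
  entry : ℤ → ℕ → ℕ
  top : ∀ i, entry i 0 = 1
  bottom : ∀ i, entry i (m + 1) = 1
  pos : ∀ i k, k ≤ m + 1 → 0 < entry i k
  diamond : ∀ i k, k < m →
    entry i (k + 1) * entry (i + 1) (k + 1) = entry (i + 1) k * entry i (k + 2) + 1

namespace CCFrieze

variable {m : ℕ}

/-- Starting from `entry i k` and following the letters of the word downwards, only `1`s are met. -/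
def OnesAlong (Γ : CCFrieze m) : ℤ → ℕ → List LR → Prop
  | i, k, [] => Γ.entry i k = 1
  | i, k, LR.L :: w => Γ.entry i k = 1 ∧ Γ.OnesAlong (i - 1) (k + 1) w
  | i, k, LR.R :: w => Γ.entry i k = 1 ∧ Γ.OnesAlong i (k + 1) w

/-- `Γ` is generated by the initial arrangement of `1`s given by `w`: it contains a zigzag line of
`1`s of shape `w` going from line `1` to line `m`. By the diamond rule these entries determine
`Γ` up to a horizontal translation. -/
def IsGeneratedBy (Γ : CCFrieze m) (w : List LR) : Prop :=
  w.length + 1 = m ∧ ∃ i : ℤ, Γ.OnesAlong i 1 w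

/-- `Γ` is of zigzag type: a zigzag line of `1`s connects the ceiling and the floor. -/
def IsZigzagType (Γ : CCFrieze m) : Prop :=
  ∃ w : List LR, Γ.IsGeneratedBy w

/-- Two friezes are equivalent if one is obtained from the other by a horizontal translation,
composed possibly with the reflection in a vertical line, with the reflection in the middle
horizontal line, or with both. -/
def Equivalent (Γ Γ' : CCFrieze m) : Prop :=
  ∃ c : ℤ,
    (∀ i k, k ≤ m + 1 → Γ'.entry i k = Γ.entry (i + c) k) ∨
    (∀ i k, k ≤ m + 1 → Γ'.entry i k = Γ.entry (c - i - k) k) ∨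
    (∀ i k, k ≤ m + 1 → Γ'.entry i k = Γ.entry (i + k + c) (m + 1 - k)) ∨
    (∀ i k, k ≤ m + 1 → Γ'.entry i k = Γ.entry (c - i) (m + 1 - k))

/-- `Γ = Γ_α` up to equivalence, where `Γ_α` is the frieze generated by the word of `α`. -/
def IsFriezeOf (Γ : CCFrieze m) (α : ℚ) : Prop :=
  ∃ (Γ' : CCFrieze m) (w : List LR), IsWord α w ∧ Γ'.IsGeneratedBy w ∧ Γ.Equivalent Γ'

end CCFrieze

/-! ### Link diagrams, the Kauffman bracket, writhe and Jones polynomial -/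

/-- A link diagram, cut at finitely many points (labelled by `P`) into crossings (labelled by `C`) and
arcs without crossings (labelled by `E`). A point `p` has two sides,
`(p, false)` and `(p, true)`, and each side belongs to exactly one end of an arc or of a crossing.
The four corners of a crossing are numbered `0, 1, 2, 3` counterclockwise; the strand `0 – 2`
passes under the strand `1 – 3`. -/
structure LinkDiagram (P C E : Type) where
  corner : C → Fin 4 → P × Bool
  arcEnd : E → Bool → P × Bool
  bijective : Function.Bijective
    (Sum.elim (fun x : C × Fin 4 => corner x.1 x.2) (fun x : E × Bool => arcEnd x.1 x.2))

namespace LinkDiagram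

variable {P C E : Type} (D : LinkDiagram P C E)

/-- `x` and `y` are joined by an arc, or by one of the two arcs replacing a crossing in the state
`σ`. The smoothing `σ c = true` is the `A`-smoothing, which merges the two regions swept out when
the over-strand `1 – 3` is turned counterclockwise, and so joins corners `0, 1` and `2, 3`;
the other smoothing joins `1, 2` and `3, 0`. -/
def Joined (σ : C → Bool) (x y : P) : Prop :=
  (∃ e, (D.arcEnd e false).1 = x ∧ (D.arcEnd e true).1 = y) ∨
  (∃ c, σ c = true ∧
    (((D.corner c 0).1 = x ∧ (D.corner c 1).1 = y) ∨
      ((D.corner c 2).1 = x ∧ (D.corner c 3).1 = y))) ∨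
  (∃ c, σ c = false ∧
    (((D.corner c 1).1 = x ∧ (D.corner c 2).1 = y) ∨
      ((D.corner c 3).1 = x ∧ (D.corner c 0).1 = y)))

/-- The number of circles in the state `σ`: the number of connected components. -/
noncomputable def loops (σ : C → Bool) : ℕ :=
  Nat.card (Quot (D.Joined σ))

/-- The Kauffman bracket, a Laurent polynomial in `A = T 1`, as the sum over all states; here
`-A² - A⁻²` is the value of an additional circle, and a single circle has the value `1`. -/
noncomputable def bracket [Fintype C] [DecidableEq C] : ℤ[T;T⁻¹] :=
  ∑ σ : C → Bool,
    (∏ c, LaurentPolynomial.T (if σ c = true then (1 : ℤ) else -1)) *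
      (-LaurentPolynomial.T 2 - LaurentPolynomial.T (-2)) ^ (D.loops σ - 1)

/-- Directions along the strands are given by a sign at each point `p`: `1` if the strand goes from
the side `(p, false)` to the side `(p, true)`, and `-1` otherwise. For an end of an arc or crossing
attached to a side of `p`, `outward` is `1` if the strand leaves the arc or crossing there, and `-1`
if it enters. -/
def outward (o : P → ℤˣ) (x : P × Bool) : ℤˣ :=
  if x.2 = true then -o x.1 else o x.1

/-- The directions fit together along all arcs and through all crossings. -/
def IsOrientation (o : P → ℤˣ) : Prop :=
  (∀ e, outward o (D.arcEnd e false) = -outward o (D.arcEnd e true)) ∧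
  (∀ c, outward o (D.corner c 0) = -outward o (D.corner c 2)) ∧
  (∀ c, outward o (D.corner c 1) = -outward o (D.corner c 3))

/-- The sign of a crossing. If the under-strand runs from corner `0` to corner `2`, the crossing is
positive if the over-strand runs from corner `3` to corner `1`, and negative otherwise. -/
def crossingSign (o : P → ℤˣ) (c : C) : ℤˣ :=
  outward o (D.corner c 2) * outward o (D.corner c 1)

/-- The writhe: the sum of the signs of all crossings. -/
def writhe [Fintype C] (o : P → ℤˣ) : ℤ :=
  ∑ c, (D.crossingSign o c : ℤ)

/-- `(-A³)ⁿ` for an integer `n`. -/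
noncomputable def negCube (n : ℤ) : ℤ[T;T⁻¹] :=
  LaurentPolynomial.C (n.negOnePow : ℤ) * LaurentPolynomial.T (3 * n)

/-- The Jones polynomial `(-A³)^{-wr} ⟨D⟩` of the oriented diagram, in the variable `A`. -/
noncomputable def jones [Fintype C] [DecidableEq C] (o : P → ℤˣ) : ℤ[T;T⁻¹] :=
  negCube (-D.writhe o) * D.bracket

end LinkDiagram

/-! ### The diagrams of rational links -/

namespace Plat

/-- The labels of the arcs in a closed four-strand braid diagram: the pieces of the strands that
pass a crossing without taking part in it, two arcs closing the left end, two closing the right. -/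
abbrev ArcIndex {N : ℕ} (b : Fin N → Fin 3 × Bool) : Type :=
  {x : Fin N × Fin 4 // x.2 ≠ (b x.1).1.castSucc ∧ x.2 ≠ (b x.1).1.succ} ⊕ (Bool ⊕ Bool)

/-- The corners of the `k`-th crossing, which lies between the levels `k` and `k + 1` and involves the
strand positions `i` (upper) and `i + 1` (lower), where `b k = (i, ε)`. The over-strand runs from
lower left to upper right if `ε = true`, and from upper left to lower right if `ε = false`. -/
def corner {N : ℕ} (b : Fin N → Fin 3 × Bool) (k : Fin N) :
    Fin 4 → (Fin (N + 1) × Fin 4) × Bool :=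
  let i := (b k).1
  let nw := ((k.castSucc, i.castSucc), true)
  let sw := ((k.castSucc, i.succ), true)
  let ne := ((k.succ, i.castSucc), false)
  let se := ((k.succ, i.succ), false)
  if (b k).2 = true then ![se, ne, nw, sw] else ![ne, nw, sw, se]

/-- The ends of the arcs. On the left the positions `0, 1` and `2, 3` are joined, on the right the
positions `0, 3` and `1, 2`. -/
def arcEnd {N : ℕ} (b : Fin N → Fin 3 × Bool) :
    ArcIndex b → Bool → (Fin (N + 1) × Fin 4) × Bool
  | Sum.inl x, false => ((x.1.1.castSucc, x.1.2), true)
  | Sum.inl x, true => ((x.1.1.succ, x.1.2), false)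
  | Sum.inr (Sum.inl false), false => ((0, 0), false)
  | Sum.inr (Sum.inl false), true => ((0, 1), false)
  | Sum.inr (Sum.inl true), false => ((0, 2), false)
  | Sum.inr (Sum.inl true), true => ((0, 3), false)
  | Sum.inr (Sum.inr false), false => ((Fin.last N, 0), true)
  | Sum.inr (Sum.inr false), true => ((Fin.last N, 3), true)
  | Sum.inr (Sum.inr true), false => ((Fin.last N, 1), true)
  | Sum.inr (Sum.inr true), true => ((Fin.last N, 2), true)

theorem surjective {N : ℕ} (b : Fin N → Fin 3 × Bool) : Function.Surjective
    (Sum.elim (fun x : Fin N × Fin 4 => corner b x.1 x.2)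
      (fun x : ArcIndex b × Bool => arcEnd b x.1 x.2)) := by
  have key : ∀ (k : Fin N) (j : Fin 4) (s : Bool),
      ∃ a, Sum.elim (fun x : Fin N × Fin 4 => corner b x.1 x.2)
        (fun x : ArcIndex b × Bool => arcEnd b x.1 x.2) a
          = ((if s = true then k.castSucc else k.succ, j), s) := by
    intro k j s
    by_cases h1 : j = (b k).1.castSucc
    · refine ⟨Sum.inl (k, if (b k).2 = true then (if s = true then 2 else 1)
        else (if s = true then 1 else 0)), ?_⟩
      cases s <;> cases hb : (b k).2 <;> simp [corner, hb, h1]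
    by_cases h2 : j = (b k).1.succ
    · refine ⟨Sum.inl (k, if (b k).2 = true then (if s = true then 3 else 0)
        else (if s = true then 2 else 3)), ?_⟩
      cases s <;> cases hb : (b k).2 <;> simp [corner, hb, h2]
    · refine ⟨Sum.inr (Sum.inl ⟨(k, j), h1, h2⟩, !s), ?_⟩
      cases s <;> simp [arcEnd]
  rintro ⟨⟨k, j⟩, s⟩
  cases s
  · induction k using Fin.cases with
    | zero =>
      fin_cases j
      · exact ⟨Sum.inr (Sum.inr (Sum.inl false), false), rfl⟩
      · exact ⟨Sum.inr (Sum.inr (Sum.inl false), true), rfl⟩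
      · exact ⟨Sum.inr (Sum.inr (Sum.inl true), false), rfl⟩
      · exact ⟨Sum.inr (Sum.inr (Sum.inl true), true), rfl⟩
    | succ k => simpa using key k j false
  · induction k using Fin.lastCases with
    | last =>
      fin_cases j
      · exact ⟨Sum.inr (Sum.inr (Sum.inr false), false), rfl⟩
      · exact ⟨Sum.inr (Sum.inr (Sum.inr true), false), rfl⟩
      · exact ⟨Sum.inr (Sum.inr (Sum.inr true), true), rfl⟩
      · exact ⟨Sum.inr (Sum.inr (Sum.inr false), true), rfl⟩
    | cast k => simpa using key k j true

theorem bijective {N : ℕ} (b : Fin N → Fin 3 × Bool) : Function.Bijective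
    (Sum.elim (fun x : Fin N × Fin 4 => corner b x.1 x.2)
      (fun x : ArcIndex b × Bool => arcEnd b x.1 x.2)) := by
  rw [Fintype.bijective_iff_surjective_and_card]
  refine ⟨surjective b, ?_⟩
  have h3 : ∀ i : Fin 3, Fintype.card {j : Fin 4 // j ≠ i.castSucc ∧ j ≠ i.succ} = 2 := by decide
  have h : Fintype.card {x : Fin N × Fin 4 // x.2 ≠ (b x.1).1.castSucc ∧ x.2 ≠ (b x.1).1.succ}
      = N * 2 := by
    rw [Fintype.card_congr (Equiv.subtypeProdEquivSigmaSubtype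
      (fun (k : Fin N) (j : Fin 4) => j ≠ (b k).1.castSucc ∧ j ≠ (b k).1.succ)),
      Fintype.card_sigma]
    simp [h3]
  simp only [ArcIndex, Fintype.card_sum, Fintype.card_prod, Fintype.card_fin, Fintype.card_bool, h]
  ring

/-- The diagram obtained from a braid diagram on four horizontal strands, with strand positions
`0, 1, 2, 3` from top to bottom and levels `0, …, N` from left to right, by closing it on the left
and on the right. The point `(k, j)` is the point at level `k` and position `j`; its side `false` is
the left one, its side `true` the right one. -/
def diagram {N : ℕ} (b : Fin N → Fin 3 × Bool) :
    LinkDiagram (Fin (N + 1) × Fin 4) (Fin N) (ArcIndex b) where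
  corner := corner b
  arcEnd := arcEnd b
  bijective := bijective b

/-- The crossings of the rational link diagram with twist regions of `a₁, …, aₙ` crossings, which
alternate between the positions `1, 2` and the positions `0, 1`; the diagram is alternating. -/
def twists : Bool → List ℕ → List (Fin 3 × Bool)
  | _, [] => []
  | true, a :: l => List.replicate a (1, true) ++ twists false l
  | false, a :: l => List.replicate a (0, false) ++ twists true l

end Plat

/-- The crossings of `D(T(α))` from left to right. -/
noncomputable def rationalBraid (α : ℚ) : List (Fin 3 × Bool) :=
  Plat.twists true (evenExpansion α)

/-- The diagram `D(T(α))` of the rational link of `α = [0, a₁, …, aₙ] ∈ (0,1)`, `n` even. -/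
noncomputable def rationalLink (α : ℚ) :=
  Plat.diagram (rationalBraid α).get

/-- The orientation chosen on `D(T(α))`: the strand at the upper left goes to the right, and if the
link has two components, that is, if the denominator of `α` is even, then the two strands entering
the first twist region from the left have opposite directions. -/
def IsStandardOrientation (α : ℚ) (o : Fin ((rationalBraid α).length + 1) × Fin 4 → ℤˣ) : Prop :=
  (rationalLink α).IsOrientation o ∧ o (0, 0) = 1 ∧ (Even α.den → o (0, 1) = -o (0, 2))

open Classical in
/-- The Jones polynomial `V(α)` of `D(T(α))` with the chosen orientation, in the variable `A`. -/
noncomputable def jonesV (α : ℚ) : ℤ[T;T⁻¹] :=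
  if h : ∃ o, IsStandardOrientation α o then (rationalLink α).jones h.choose else 0

/-- The class of `V(α)`, as the set of Laurent polynomials identified with each other, for
`α = p / q` with parents having the numerators `x` and `y`. The bar `A ↦ A⁻¹` is
`LaurentPolynomial.invert`, and `i(α) = (q - p) / q = 1 - α`. -/
noncomputable def jonesClass (α : ℚ) (x y : ℕ) : Set ℤ[T;T⁻¹] :=
  {f | (Odd α.den ∧ (f = jonesV α ∨ f = LaurentPolynomial.invert (jonesV α))) ∨
    (Even α.den ∧ Even x ∧ (f = jonesV α ∨ f = jonesV (1 - α))) ∨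
    (Even α.den ∧ Even y ∧ (f = jonesV α ∨ f = jonesV (1 - α) ∨
      f = LaurentPolynomial.invert (jonesV (1 - α)) ∨ f = LaurentPolynomial.invert (jonesV α)))}

/-- The substitution `t = A⁻⁴`, turning a Laurent polynomial in the variable `t^{1/2}` into one in
the variable `A`: `t^{1/2} ↦ A⁻²`. -/
noncomputable def substHalf (g : ℤ[T;T⁻¹]) : ℤ[T;T⁻¹] :=
  AddMonoidAlgebra.mapDomain (fun n : ℤ => -2 * n) g

/-!
The rational numbers in `(0,1)` correspond to the words in `L` and `R`: the word of `α` is its path in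
the Stern–Brocot tree (`IsWord.eq_wordRat`, `isWord_wordRat`), and the crossings of the diagram
`D(T(α))` are `L`, the reversed word, and `R`, when `L` stands for a crossing at the middle positions
and `R` for one at the upper positions (`rationalBraid_wordRat`). Two facts then give the theorem.

*A frieze determines its words up to reversal and interchange of the letters.* The entries of a frieze
are determinants of pairs of vertices of a centrally symmetric polygon (`CCFrieze.det_vec`,
`CCFrieze.vec_antiperiodic`). By the Ptolemy relation, two `1`s cannot stand at crossing diagonals
(`CCFrieze.not_crossing`), so all zigzag lines of `1`s in a frieze are translates of a single one and
of its glide reflection (`CCFrieze.IsGeneratedBy.wordRel`). The identifications of friezes act on words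
by the same two operations (`CCFrieze.IsGeneratedBy.of_equivalent`).

*The class of Jones polynomials is invariant under these operations.* Removing crossings from the left,
the state sum becomes a product of `2 × 2` transfer matrices (`closedBracket_eq_gluing`), one for each
letter, acting on the two ways of joining four points in the plane. The first crossing with the arcs on
the left and the last crossing with the arcs on the right give the same vector, the matrices are
self-adjoint for the form that glues two such pairs of arcs, and `A ↦ A⁻¹` together with the exchange
of the two basis vectors exchanges the matrices. So the bracket is unchanged if the word is reversed,
and conjugated if its letters are interchanged (`wordBracket_reverse`, `wordBracket_map_swap`). The
writhe only depends on which strands are parallel; there are three possibilities, permuted by the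
crossings, and the resulting permutation of three elements encodes the parities of `x`, `r`, `y`, `s`
(`even_wordParents`). Reversing and reflecting paths of orientation types gives the behaviour of the
writhe (`linkWrithe_reverse`, `linkWrithe_map_swap`), and the three cases in the definition of the
class are those where the permutation moves the middle type, is trivial, or exchanges the two outer
types. In the last case reversing the word changes the orientation of one component, and this is why
the class then has to contain the mirror images as well (`jonesV_reverse_of_swap`).
-/

/-! ### Parents of a rational number -/

/-- Parents are unique: the conditions say that `r` is the inverse of `α.num` modulo `α.den`, lying
between `0` and `α.den`. -/
theorem IsParents.unique {α : ℚ} (hα : α < 1) {x r y s x' r' y' s' : ℕ} (h : IsParents α x r y s)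
    (h' : IsParents α x' r' y' s') : x' = x ∧ r' = r ∧ y' = y ∧ s' = s := by
  obtain ⟨h1, h2, h3⟩ := h
  obtain ⟨h1', h2', h3'⟩ := h'
  have hlt : α.num < α.den := Rat.num_lt_denom_iff.mpr hα
  zify at h1 h1' h3 h3'
  have hs : 0 < s := by
    rcases Nat.eq_zero_or_pos s with rfl | hs
    · exfalso
      -- `s = 0` forces `r = y = 1`, hence `α.den = 1 ≤ α.num`
      have : (r : ℤ) = 1 := by
        have := Int.eq_one_or_neg_one_of_mul_eq_one (show (r : ℤ) * y = 1 by simpa using h1)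
        omega
      push_cast at h3
      have : (y : ℤ) = 1 := by rw [this] at h1; simpa using h1
      omega
    · exact hs
  have hs' : 0 < s' := by
    rcases Nat.eq_zero_or_pos s' with rfl | hs
    · exfalso
      have : (r' : ℤ) = 1 := by
        have := Int.eq_one_or_neg_one_of_mul_eq_one (show (r' : ℤ) * y' = 1 by simpa using h1')
        omega
      push_cast at h3'
      have : (y' : ℤ) = 1 := by rw [this] at h1'; simpa using h1'
      omega
    · exact hs
  have hq : (0 : ℤ) < α.den := by exact_mod_cast α.pos
  have hr : 0 < r := by
    rcases Nat.eq_zero_or_pos r with rfl | hr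
    · exfalso
      have : (0 : ℤ) ≤ x * s := by positivity
      push_cast at h1; linarith
    · exact hr
  have hr' : 0 < r' := by
    rcases Nat.eq_zero_or_pos r' with rfl | hr
    · exfalso
      have : (0 : ℤ) ≤ x' * s' := by positivity
      push_cast at h1'; linarith
    · exact hr
  have e1 : (r : ℤ) * α.num - x * α.den = 1 := by rw [h2, h3]; linarith
  have e2 : (r' : ℤ) * α.num - x' * α.den = 1 := by rw [h2', h3']; linarith
  have hcop : IsCoprime (α.den : ℤ) α.num := by
    exact ⟨-x, r, by linarith⟩
  have hdvd : (α.den : ℤ) ∣ ((r' : ℤ) - r) := by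
    refine hcop.dvd_of_dvd_mul_right ⟨(x' : ℤ) - x, by linarith⟩
  have hr0 : (r' : ℤ) - r = 0 := by
    refine Int.eq_zero_of_abs_lt_dvd hdvd ?_
    rw [abs_lt]; constructor <;> omega
  have hrr : (r' : ℤ) = r := by linarith
  have hxx : (x' : ℤ) = x := by
    have : ((x' : ℤ) - x) * α.den = 0 := by rw [hrr] at e2; linarith
    rcases mul_eq_zero.mp this with h | h <;> omega
  omega

/-- Every `α ∈ (0,1)` has parents. -/
theorem exists_isParents {α : ℚ} (h0 : 0 < α) (h1 : α < 1) :
    ∃ x r y s : ℕ, IsParents α x r y s := by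
  have hp : 0 < α.num := Rat.num_pos.mpr h0
  have hq : (0 : ℤ) < α.den := by exact_mod_cast α.pos
  have hlt : α.num < α.den := Rat.num_lt_denom_iff.mpr h1
  have hcop : IsCoprime (α.num) (α.den : ℤ) := by
    rw [Int.isCoprime_iff_nat_coprime]; exact α.reduced
  obtain ⟨a, b, hab⟩ := hcop
  -- reduce the Bézout coefficient `a` modulo the denominator
  set r : ℤ := a % α.den with hr
  set x : ℤ := -(b + a / α.den * α.num) with hx
  have har : a = r + a / α.den * α.den := by rw [hr]; linarith [Int.emod_add_mul_ediv a α.den]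
  have key : r * α.num - x * α.den = 1 := by
    rw [hx]; rw [har] at hab; linarith
  have hr0 : 0 ≤ r := Int.emod_nonneg _ hq.ne'
  have hrq : r < α.den := Int.emod_lt_of_pos _ hq
  have hx0 : 0 ≤ x := by
    by_contra hneg
    have h2 : x ≤ -1 := by omega
    nlinarith [mul_nonneg hr0 hp.le]
  have hxp : x ≤ α.num := by
    by_contra hneg
    have h2 : α.num + 1 ≤ x := by omega
    nlinarith
  refine ⟨x.toNat, r.toNat, (α.num - x).toNat, (α.den - r).toNat, ?_, ?_, ?_⟩
  · zify
    rw [Int.toNat_of_nonneg hr0, Int.toNat_of_nonneg hx0, Int.toNat_of_nonneg (by omega),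
      Int.toNat_of_nonneg (by omega)]
    linarith
  · omega
  · omega

theorem IsParents.xor_even {α : ℚ} {x r y s : ℕ} (h : IsParents α x r y s) (he : Even α.den) :
    Xor (Even x) (Even y) := by
  obtain ⟨h1, h2, h3⟩ := h
  have hodd : Odd (x + y) := by
    rw [← Nat.not_even_iff_odd]
    intro hev
    have h := α.reduced
    have h4 : α.num.natAbs = x + y := by omega
    rw [h4] at h
    exact Nat.not_coprime_of_dvd_of_dvd one_lt_two hev.two_dvd he.two_dvd h
  rw [Nat.odd_add] at hodd
  rcases Nat.even_or_odd x with hx | hx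
  · exact Or.inl ⟨hx, fun hy => Nat.not_even_iff_odd.mpr (hodd.mpr hy) hx⟩
  · exact Or.inr ⟨hodd.mp hx, Nat.not_even_iff_odd.mpr hx⟩

/-! ### The rational number of a word -/

/-- The parents `x / r`, `y / s` of the rational number with a given word, as `(x, r, y, s)`. A first
letter `L` replaces `α` by the mediant of its left parent and `α`, a first letter `R` by the mediant
of `α` and its right parent. -/
def wordParents : List LR → ℕ × ℕ × ℕ × ℕ
  | [] => (0, 1, 1, 1)
  | LR.L :: w => ((wordParents w).1, (wordParents w).2.1,
      (wordParents w).1 + (wordParents w).2.2.1, (wordParents w).2.1 + (wordParents w).2.2.2)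
  | LR.R :: w => ((wordParents w).1 + (wordParents w).2.2.1,
      (wordParents w).2.1 + (wordParents w).2.2.2, (wordParents w).2.2.1, (wordParents w).2.2.2)

/-- The rational number in `(0,1)` with a given word. -/
def wordRat (w : List LR) : ℚ :=
  (((wordParents w).1 + (wordParents w).2.2.1 : ℕ) : ℚ) /
    (((wordParents w).2.1 + (wordParents w).2.2.2 : ℕ) : ℚ)

theorem wordParents_det (w : List LR) :
    (wordParents w).2.1 * (wordParents w).2.2.1 =
      (wordParents w).1 * (wordParents w).2.2.2 + 1 := by
  induction w with
  | nil => rfl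
  | cons c w ih => cases c <;> simp only [wordParents] <;> linarith

theorem wordParents_pos (w : List LR) :
    0 < (wordParents w).2.1 ∧ 0 < (wordParents w).2.2.1 ∧ 0 < (wordParents w).2.2.2 ∧
    (wordParents w).1 < (wordParents w).2.1 ∧ (wordParents w).2.2.1 ≤ (wordParents w).2.2.2 := by
  induction w with
  | nil => simp [wordParents]
  | cons c w ih => cases c <;> simp only [wordParents] <;> omega

theorem isParents_of_mediant {x r y s : ℕ} (h : r * y = x * s + 1) (hs : 0 < r + s) :
    IsParents (((x + y : ℕ) : ℚ) / ((r + s : ℕ) : ℚ)) x r y s := by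
  have hc : Nat.Coprime (x + y) (r + s) := by
    rw [← Nat.isCoprime_iff_coprime]
    refine ⟨r, -x, ?_⟩
    zify at h; push_cast; linarith
  have hc' : Nat.Coprime ((x + y : ℕ) : ℤ).natAbs ((r + s : ℕ) : ℤ).natAbs := by
    rwa [Int.natAbs_natCast, Int.natAbs_natCast]
  refine ⟨h, ?_, ?_⟩
  · have := Rat.num_div_eq_of_coprime (a := ((x + y : ℕ) : ℤ)) (b := ((r + s : ℕ) : ℤ))
      (by exact_mod_cast hs) hc'
    push_cast at this ⊢; exact this
  · have := Rat.den_div_eq_of_coprime (a := ((x + y : ℕ) : ℤ)) (b := ((r + s : ℕ) : ℤ))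
      (by exact_mod_cast hs) hc'
    push_cast at this ⊢; exact_mod_cast this

theorem isParents_wordRat (w : List LR) :
    IsParents (wordRat w) (wordParents w).1 (wordParents w).2.1 (wordParents w).2.2.1
      (wordParents w).2.2.2 :=
  isParents_of_mediant (wordParents_det w) (by have := wordParents_pos w; omega)

theorem wordRat_pos (w : List LR) : 0 < wordRat w := by
  have := wordParents_pos w
  unfold wordRat
  apply div_pos <;> · rw [Nat.cast_pos]; omega

theorem wordRat_lt_one (w : List LR) : wordRat w < 1 := by
  have := wordParents_pos w
  unfold wordRat
  rw [div_lt_one (by rw [Nat.cast_pos]; omega), Nat.cast_lt]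
  omega

theorem IsParents.eq_div {α : ℚ} {x r y s : ℕ} (h : IsParents α x r y s) :
    α = ((x + y : ℕ) : ℚ) / ((r + s : ℕ) : ℚ) := by
  rw [← Rat.num_div_den α, h.2.1, h.2.2]
  push_cast; rfl

theorem isWord_wordRat (w : List LR) : IsWord (wordRat w) w := by
  induction w with
  | nil =>
    have : wordRat [] = 1 / 2 := by norm_num [wordRat, wordParents]
    rw [this]; exact IsWord.half
  | cons c w ih =>
    have hp := wordParents_pos w
    cases c
    · refine IsWord.left (isParents_wordRat _) ?_ ?_
      · simp only [wordParents]; omega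
      · exact ih
    · refine IsWord.right (isParents_wordRat _) ?_ ?_
      · simp only [wordParents]; omega
      · exact ih

/-- A rational number is determined by its word. -/
theorem IsWord.eq_wordRat {α : ℚ} {w : List LR} (h : IsWord α w) : α = wordRat w := by
  induction h with
  | half => norm_num [wordRat, wordParents]
  | @left α x r y s w h hrs hw ih =>
    -- the parents of the right parent `y / s` are `x / r` and `(y - x) / (s - r)`
    have hxy : x ≤ y := by
      have := h.1
      by_contra hlt
      nlinarith
    have hpar : IsParents ((y : ℚ) / s) x r (y - x) (s - r) := by
      have := isParents_of_mediant (x := x) (r := r) (y := y - x) (s := s - r) ?_ (by omega)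
      · rwa [show x + (y - x) = y by omega, show r + (s - r) = s by omega] at this
      · have := h.1
        zify [hxy, hrs.le] at this ⊢
        linarith
    rw [ih] at hpar
    obtain ⟨e1, e2, e3, e4⟩ := (isParents_wordRat w).unique (wordRat_lt_one w) hpar
    rw [h.eq_div]
    simp only [wordRat, wordParents]
    congr 2 <;> omega
  | @right α x r y s w h hrs hw ih =>
    have hxy : y ≤ x := by
      have := h.1
      by_contra hlt
      have hx : 0 < x := by
        rcases Nat.eq_zero_or_pos x with rfl | hx
        · exact absurd (wordRat_pos w) (by rw [← ih]; simp)
        · exact hx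
      nlinarith
    have hpar : IsParents ((x : ℚ) / r) (x - y) (r - s) y s := by
      have := isParents_of_mediant (x := x - y) (r := r - s) (y := y) (s := s) ?_ (by omega)
      · rwa [show x - y + y = x by omega, show r - s + s = r by omega] at this
      · have := h.1
        zify [hxy, hrs.le] at this ⊢
        linarith
    rw [ih] at hpar
    obtain ⟨e1, e2, e3, e4⟩ := (isParents_wordRat w).unique (wordRat_lt_one w) hpar
    rw [h.eq_div]
    simp only [wordRat, wordParents]
    congr 2 <;> omega

/-- Interchange of the two letters. -/
def LR.swap : LR → LR
  | LR.L => LR.R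
  | LR.R => LR.L

@[simp] theorem LR.swap_swap (c : LR) : c.swap.swap = c := by cases c <;> rfl

theorem wordParents_map_swap (w : List LR) :
    (wordParents (w.map LR.swap)).1 + (wordParents w).2.2.1 = (wordParents w).2.2.2 ∧
    (wordParents (w.map LR.swap)).2.1 = (wordParents w).2.2.2 ∧
    (wordParents (w.map LR.swap)).2.2.1 + (wordParents w).1 = (wordParents w).2.1 ∧
    (wordParents (w.map LR.swap)).2.2.2 = (wordParents w).2.1 := by
  induction w with
  | nil => simp [wordParents]
  | cons c w ih => cases c <;> simp only [wordParents, List.map_cons, LR.swap] <;> omega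

/-- Interchanging the letters of the word replaces `α` by `1 - α`. -/
theorem wordRat_map_swap (w : List LR) : wordRat (w.map LR.swap) = 1 - wordRat w := by
  obtain ⟨h1, h2, h3, h4⟩ := wordParents_map_swap w
  have hp := wordParents_pos w
  have hne : (((wordParents w).2.1 + (wordParents w).2.2.2 : ℕ) : ℚ) ≠ 0 := by
    rw [Nat.cast_ne_zero]; omega
  unfold wordRat
  rw [eq_sub_iff_add_eq, h2, h4, Nat.add_comm (wordParents w).2.2.2, ← add_div, div_eq_one_iff_eq hne,
    ← Nat.cast_add, Nat.cast_inj]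
  omega

/-! ### Zigzag lines of `1`s in a frieze -/

/-- Two words are related if one is obtained from the other by interchanging the letters, by
reversal, or by both. -/
def WordRel (w w' : List LR) : Prop :=
  w' = w ∨ w' = w.map LR.swap ∨ w' = w.reverse ∨ w' = (w.map LR.swap).reverse

@[simp] theorem map_swap_map_swap (w : List LR) : (w.map LR.swap).map LR.swap = w := by
  simp [Function.comp_def]

theorem WordRel.symm {w w' : List LR} (h : WordRel w w') : WordRel w' w := by
  rcases h with rfl | rfl | rfl | rfl <;> simp [WordRel, List.map_reverse, Function.comp_def]

theorem WordRel.trans {w w' w'' : List LR} (h : WordRel w w') (h' : WordRel w' w'') :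
    WordRel w w'' := by
  rcases h with rfl | rfl | rfl | rfl <;> rcases h' with rfl | rfl | rfl | rfl <;>
    simp [WordRel, List.map_reverse, Function.comp_def]

namespace CCFrieze

variable {m : ℕ}

theorem OnesAlong.head {Γ : CCFrieze m} {i : ℤ} {k : ℕ} {w : List LR} (h : Γ.OnesAlong i k w) :
    Γ.entry i k = 1 := by
  cases w with
  | nil => exact h
  | cons c w => cases c <;> exact h.1

theorem OnesAlong.translate {Γ Γ' : CCFrieze m} {c : ℤ}
    (hc : ∀ i k, k ≤ m + 1 → Γ'.entry i k = Γ.entry (i + c) k) {w : List LR} :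
    ∀ {i : ℤ} {k : ℕ}, k + w.length ≤ m + 1 → Γ'.OnesAlong i k w → Γ.OnesAlong (i + c) k w := by
  induction w with
  | nil => intro i k hk h; exact (hc i k hk).symm.trans h
  | cons l w ih =>
    intro i k hk h
    rw [List.length_cons] at hk
    cases l
    · refine ⟨(hc i k (by omega)).symm.trans h.1, ?_⟩
      have := ih (by omega) h.2
      rwa [show i - 1 + c = i + c - 1 by ring] at this
    · exact ⟨(hc i k (by omega)).symm.trans h.1, ih (by omega) h.2⟩

theorem OnesAlong.reflect_vertical {Γ Γ' : CCFrieze m} {c : ℤ}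
    (hc : ∀ i k, k ≤ m + 1 → Γ'.entry i k = Γ.entry (c - i - k) k) {w : List LR} :
    ∀ {i : ℤ} {k : ℕ}, k + w.length ≤ m + 1 → Γ'.OnesAlong i k w →
      Γ.OnesAlong (c - i - k) k (w.map LR.swap) := by
  induction w with
  | nil => intro i k hk h; exact (hc i k hk).symm.trans h
  | cons l w ih =>
    intro i k hk h
    rw [List.length_cons] at hk
    cases l
    · refine ⟨(hc i k (by omega)).symm.trans h.1, ?_⟩
      have := ih (by omega) h.2
      rwa [show c - (i - 1) - ((k + 1 : ℕ) : ℤ) = c - i - k by push_cast; ring] at this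
    · refine ⟨(hc i k (by omega)).symm.trans h.1, ?_⟩
      have := ih (by omega) h.2
      rwa [show c - i - ((k + 1 : ℕ) : ℤ) = c - i - k - 1 by push_cast; ring] at this

/-- The left end of the last diagonal met by a zigzag line starting at `i`. -/
def lastIndex : ℤ → List LR → ℤ
  | i, [] => i
  | i, LR.L :: w => lastIndex (i - 1) w
  | i, LR.R :: w => lastIndex i w

/-- A reflection in the middle line turns a zigzag line upside down; `acc` is the part of the
reflected line that has been collected already. -/
theorem OnesAlong.reflect_horizontal {Γ Γ' : CCFrieze m} {c : ℤ}
    (hc : ∀ i k, k ≤ m + 1 → Γ'.entry i k = Γ.entry (i + k + c) (m + 1 - k)) {w : List LR} :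
    ∀ {i : ℤ} {k : ℕ} {acc : List LR}, k + w.length ≤ m + 1 → Γ'.OnesAlong i k w →
      Γ.OnesAlong (i + k + c) (m + 1 - k) acc →
      Γ.OnesAlong (lastIndex i w + (k + w.length : ℕ) + c) (m + 1 - (k + w.length))
        ((w.map LR.swap).reverse ++ acc) := by
  induction w with
  | nil => intro i k acc hk h hacc; exact hacc
  | cons l w ih =>
    intro i k acc hk h hacc
    rw [List.length_cons] at hk
    have key : m + 1 - (k + 1) + 1 = m + 1 - k := by omega
    cases l
    · have h1 := (hc _ _ (show k + 1 ≤ m + 1 by omega)).symm.trans h.2.head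
      have := ih (acc := LR.R :: acc) (by omega) h.2 ⟨h1, ?_⟩
      · simpa [LR.swap, lastIndex, show k + (w.length + 1) = k + 1 + w.length by omega] using this
      · rwa [key, show i - 1 + ((k + 1 : ℕ) : ℤ) + c = i + k + c by push_cast; ring]
    · have h1 := (hc _ _ (show k + 1 ≤ m + 1 by omega)).symm.trans h.2.head
      have := ih (acc := LR.L :: acc) (by omega) h.2 ⟨h1, ?_⟩
      · simpa [LR.swap, lastIndex, show k + (w.length + 1) = k + 1 + w.length by omega] using this
      · rwa [key, show i + ((k + 1 : ℕ) : ℤ) + c - 1 = i + k + c by push_cast; ring]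

theorem OnesAlong.rotate {Γ Γ' : CCFrieze m} {c : ℤ}
    (hc : ∀ i k, k ≤ m + 1 → Γ'.entry i k = Γ.entry (c - i) (m + 1 - k)) {w : List LR} :
    ∀ {i : ℤ} {k : ℕ} {acc : List LR}, k + w.length ≤ m + 1 → Γ'.OnesAlong i k w →
      Γ.OnesAlong (c - i) (m + 1 - k) acc →
      ∃ j, Γ.OnesAlong j (m + 1 - (k + w.length)) (w.reverse ++ acc) := by
  induction w with
  | nil => intro i k acc hk h hacc; exact ⟨_, hacc⟩
  | cons l w ih =>
    intro i k acc hk h hacc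
    rw [List.length_cons] at hk
    have key : m + 1 - (k + 1) + 1 = m + 1 - k := by omega
    cases l
    · have h1 := (hc _ _ (show k + 1 ≤ m + 1 by omega)).symm.trans h.2.head
      have := ih (acc := LR.L :: acc) (by omega) h.2 ⟨h1, ?_⟩
      · simpa [show k + (w.length + 1) = k + 1 + w.length by omega] using this
      · rwa [key, show c - (i - 1) - 1 = c - i by ring]
    · have h1 := (hc _ _ (show k + 1 ≤ m + 1 by omega)).symm.trans h.2.head
      have := ih (acc := LR.R :: acc) (by omega) h.2 ⟨h1, ?_⟩
      · simpa [show k + (w.length + 1) = k + 1 + w.length by omega] using this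
      · rwa [key]

/-- Reflection in the middle line, for a zigzag line through all inner lines. -/
theorem OnesAlong.reflect_horizontal_full {Γ Γ' : CCFrieze m} {c : ℤ}
    (hc : ∀ i k, k ≤ m + 1 → Γ'.entry i k = Γ.entry (i + k + c) (m + 1 - k)) {w : List LR} {i : ℤ}
    (hw : w.length + 1 = m) (h : Γ'.OnesAlong i 1 w) :
    Γ.OnesAlong (lastIndex i w + m + c) 1 (w.map LR.swap).reverse := by
  have hj := h.reflect_horizontal hc (acc := []) (by omega)
    ((hc i 1 (by omega)).symm.trans h.head)
  rwa [show m + 1 - (1 + w.length) = 1 by omega, show 1 + w.length = m by omega,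
    List.append_nil] at hj

theorem IsGeneratedBy.of_equivalent {Γ Γ' : CCFrieze m} (hΓ : Γ.Equivalent Γ') {w : List LR}
    (h : Γ'.IsGeneratedBy w) : ∃ w', WordRel w w' ∧ Γ.IsGeneratedBy w' := by
  obtain ⟨hw, i, hi⟩ := h
  obtain ⟨c, hc | hc | hc | hc⟩ := hΓ
  · exact ⟨w, Or.inl rfl, hw, _, hi.translate hc (by omega)⟩
  · exact ⟨_, Or.inr (Or.inl rfl), by simpa using hw, _, hi.reflect_vertical hc (by omega)⟩
  · exact ⟨_, Or.inr (Or.inr (Or.inr rfl)), by simpa using hw,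
      _, hi.reflect_horizontal_full hc hw⟩
  · obtain ⟨j, hj⟩ := hi.rotate hc (acc := []) (by omega)
      ((hc i 1 (by omega)).symm.trans hi.head)
    rw [show m + 1 - (1 + w.length) = 1 by omega, List.append_nil] at hj
    exact ⟨_, Or.inr (Or.inr (Or.inl rfl)), by simpa using hw, j, hj⟩

/-! ### The Ptolemy relation and the glide reflection -/

/-- The linear recurrence along a diagonal, a consequence of the diamond rule. -/
theorem entry_recurrence (Γ : CCFrieze m) (k : ℕ) (hk : k < m) : ∀ i : ℤ,
    (Γ.entry i (k + 2) : ℤ) = Γ.entry (i + k + 1) 1 * Γ.entry i (k + 1) - Γ.entry i k := by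
  induction k with
  | zero =>
    intro i
    have h := Γ.diamond i 0 hk
    simp only [Γ.top] at h ⊢
    zify at h
    push_cast
    rw [add_zero]
    linarith
  | succ k ih =>
    intro i
    have h1 := ih (by omega) (i + 1)
    have d1 := Γ.diamond i (k + 1) hk
    have d2 := Γ.diamond i k (by omega)
    zify at d1 d2
    have hpos : (0 : ℤ) < Γ.entry (i + 1) (k + 1) := by
      exact_mod_cast Γ.pos (i + 1) (k + 1) (by omega)
    refine mul_left_cancel₀ hpos.ne' ?_
    push_cast at h1 ⊢
    rw [show i + 1 + (k : ℤ) + 1 = i + (k + 1) + 1 by ring] at h1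
    rw [h1] at d1
    linear_combination (-1 : ℤ) * d1 + d2

/-- A solution, to the right of `a`, of the recurrence satisfied by the diagonals of the frieze: the
vertices of a polygon in the plane whose determinants are the entries of the frieze. -/
def vec (Γ : CCFrieze m) (a : ℤ) : ℕ → ℤ × ℤ
  | 0 => (1, 0)
  | 1 => (0, 1)
  | j + 2 => ((Γ.entry (a + j) 1 : ℤ) * (vec Γ a (j + 1)).1 - (vec Γ a j).1,
      (Γ.entry (a + j) 1 : ℤ) * (vec Γ a (j + 1)).2 - (vec Γ a j).2)

/-- The determinant of two vectors in the plane. -/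
def det (u v : ℤ × ℤ) : ℤ := u.1 * v.2 - u.2 * v.1

theorem det_vec_succ (Γ : CCFrieze m) (a : ℤ) (i : ℕ) :
    det (Γ.vec a i) (Γ.vec a (i + 1)) = 1 := by
  induction i with
  | zero => simp [vec, det]
  | succ i ih =>
    rw [← ih]
    simp only [vec, det]
    ring

theorem det_vec (Γ : CCFrieze m) (a : ℤ) (i : ℕ) : ∀ k, k ≤ m + 1 →
    det (Γ.vec a i) (Γ.vec a (i + k + 1)) = Γ.entry (a + i) k
  | 0, _ => by rw [Γ.top]; simpa using Γ.det_vec_succ a i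
  | 1, _ => by
    have h := Γ.det_vec_succ a i
    simp only [vec, det] at h ⊢
    linear_combination (Γ.entry (a + i) 1 : ℤ) * h
  | k + 2, hk => by
    rw [Γ.entry_recurrence k (by omega), ← det_vec Γ a i k (by omega),
      ← det_vec Γ a i (k + 1) (by omega)]
    have : Γ.vec a (i + (k + 2) + 1) = ((Γ.entry (a + ↑(i + k + 1)) 1 : ℤ) *
      (Γ.vec a (i + k + 1 + 1)).1 - (Γ.vec a (i + k + 1)).1, (Γ.entry (a + ↑(i + k + 1)) 1 : ℤ) *
      (Γ.vec a (i + k + 1 + 1)).2 - (Γ.vec a (i + k + 1)).2) := rfl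
    rw [this, show a + ((i + k + 1 : ℕ) : ℤ) = a + i + k + 1 by push_cast; ring,
      show i + (k + 1) + 1 = i + k + 1 + 1 by ring]
    simp only [det]
    ring

/-- The polygon is centrally symmetric with period `m + 3`: both sides have determinant `1` with two
neighbouring vertices that are linearly independent. -/
theorem vec_antiperiodic (Γ : CCFrieze m) (a : ℤ) :
    Γ.vec a (m + 3) = -Γ.vec a 0 := by
  have h1 := Γ.det_vec a 1 (m + 1) le_rfl
  have h2 := Γ.det_vec_succ a (m + 2)
  have h3 := Γ.det_vec a 0 (m + 1) le_rfl
  have h4 := Γ.det_vec a 1 m (by omega)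
  rw [Γ.bottom] at h1 h3
  have hpos : (0 : ℤ) < Γ.entry (a + (1 : ℕ)) m := by exact_mod_cast Γ.pos _ m (by omega)
  rw [show 1 + (m + 1) + 1 = m + 3 by ring] at h1
  rw [show 1 + m + 1 = m + 2 by ring] at h4
  rw [show m + 2 + 1 = m + 3 by ring] at h2
  rw [show 0 + (m + 1) + 1 = m + 2 by ring] at h3
  rw [← h4] at hpos
  generalize Γ.vec a (m + 3) = u at *
  generalize Γ.vec a (m + 2) = v at *
  simp only [vec, det, Prod.ext_iff, Prod.fst_neg, Prod.snd_neg] at *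
  push_cast at h1 h3
  have hu : u.1 = -1 := by linarith
  have hv : v.2 = 1 := by linarith
  rw [hu, hv] at h2
  refine ⟨hu, ?_⟩
  have : v.1 * u.2 = 0 := by linarith
  rcases mul_eq_zero.mp this with h | h
  · rw [h] at hpos; simp at hpos
  · simpa using h

/-- The glide symmetry of a frieze. -/
theorem entry_glide (Γ : CCFrieze m) (i : ℤ) (k : ℕ) (hk : k ≤ m + 1) :
    Γ.entry i k = Γ.entry (i + k + 1) (m + 1 - k) := by
  have h1 := Γ.det_vec i 0 k hk
  have h2 := Γ.det_vec i (k + 1) (m + 1 - k) (by omega)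
  rw [show k + 1 + (m + 1 - k) + 1 = m + 3 by omega, Γ.vec_antiperiodic] at h2
  zify
  rw [show i + (k : ℤ) + 1 = i + ((k + 1 : ℕ) : ℤ) by push_cast; ring, ← h2]
  rw [show i = i + ((0 : ℕ) : ℤ) by simp, ← h1]
  simp [det]
  ring

/-- Two `1`s cannot stand at crossing diagonals of the polygon: by the Ptolemy relation the product
of the entries at two crossing diagonals is at least `2`. -/
theorem not_crossing (Γ : CCFrieze m) (a : ℤ) {p q r : ℕ} (hp : 0 < p) (hq : p < q) (hr : q < r)
    (hm : r ≤ m + 2) (h1 : Γ.entry a (q - 1) = 1) (h2 : Γ.entry (a + p) (r - p - 1) = 1) :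
    False := by
  have e1 := Γ.det_vec a 0 (q - 1) (by omega)
  have e2 := Γ.det_vec a p (r - p - 1) (by omega)
  have e3 := Γ.det_vec a 0 (p - 1) (by omega)
  have e4 := Γ.det_vec a q (r - q - 1) (by omega)
  have e5 := Γ.det_vec a 0 (r - 1) (by omega)
  have e6 := Γ.det_vec a p (q - p - 1) (by omega)
  have p3 : (0 : ℤ) < Γ.entry (a + (0 : ℕ)) (p - 1) := by exact_mod_cast Γ.pos _ _ (by omega)
  have p4 : (0 : ℤ) < Γ.entry (a + q) (r - q - 1) := by exact_mod_cast Γ.pos _ _ (by omega)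
  have p5 : (0 : ℤ) < Γ.entry (a + (0 : ℕ)) (r - 1) := by exact_mod_cast Γ.pos _ _ (by omega)
  have p6 : (0 : ℤ) < Γ.entry (a + p) (q - p - 1) := by exact_mod_cast Γ.pos _ _ (by omega)
  rw [show a + ((0 : ℕ) : ℤ) = a by simp] at e1
  rw [h1] at e1
  rw [h2] at e2
  rw [← e3, show 0 + (p - 1) + 1 = p by omega] at p3
  rw [← e4, show q + (r - q - 1) + 1 = r by omega] at p4
  rw [← e5, show 0 + (r - 1) + 1 = r by omega] at p5
  rw [← e6, show p + (q - p - 1) + 1 = q by omega] at p6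
  rw [show 0 + (q - 1) + 1 = q by omega] at e1
  rw [show p + (r - p - 1) + 1 = r by omega] at e2
  have ptolemy : det (Γ.vec a 0) (Γ.vec a q) * det (Γ.vec a p) (Γ.vec a r) =
      det (Γ.vec a 0) (Γ.vec a p) * det (Γ.vec a q) (Γ.vec a r) +
      det (Γ.vec a 0) (Γ.vec a r) * det (Γ.vec a p) (Γ.vec a q) := by
    simp only [det]; ring
  rw [e1, e2] at ptolemy
  have := mul_pos p3 p4
  have := mul_pos p5 p6
  push_cast at ptolemy
  omega

/-! ### Uniqueness of the zigzag line -/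

/-- The zigzag line from its first entry is unique: two different continuations would meet crossing
diagonals. -/
theorem OnesAlong.unique {Γ : CCFrieze m} {w w' : List LR} :
    ∀ {i : ℤ} {k : ℕ}, 1 ≤ k → k + w.length ≤ m → w'.length = w.length → Γ.OnesAlong i k w →
      Γ.OnesAlong i k w' → w' = w := by
  have cross : ∀ (i : ℤ) (k : ℕ), 1 ≤ k → k + 1 ≤ m → Γ.entry (i - 1) (k + 1) = 1 →
      Γ.entry i (k + 1) = 1 → False := by
    intro i k hk hm h1 h2
    refine Γ.not_crossing (i - 1) (p := 1) (q := k + 2) (r := k + 3) (by omega) (by omega)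
      (by omega) (by omega) h1 ?_
    rw [show i - 1 + ((1 : ℕ) : ℤ) = i by push_cast; ring]
    exact h2
  induction w generalizing w' with
  | nil => intro i k _ _ hl _ _; exact List.length_eq_zero_iff.mp hl
  | cons c w ih =>
    intro i k hk hkm hl h h'
    rw [List.length_cons] at hkm
    cases w' with
    | nil => simp at hl
    | cons c' w' =>
      simp only [List.length_cons, add_left_inj] at hl
      cases c <;> cases c'
      · rw [ih (by omega) (by omega) hl h.2 h'.2]
      · exact (cross i k hk (by omega) h.2.head h'.2.head).elim
      · exact (cross i k hk (by omega) h'.2.head h.2.head).elim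
      · rw [ih (by omega) (by omega) hl h.2 h'.2]

theorem OnesAlong.last {Γ : CCFrieze m} {w : List LR} : ∀ {i : ℤ} {k : ℕ}, Γ.OnesAlong i k w →
    Γ.entry (lastIndex i w) (k + w.length) = 1 := by
  induction w with
  | nil => intro i k h; exact h
  | cons c w ih =>
    intro i k h
    rw [List.length_cons, show k + (w.length + 1) = k + 1 + w.length by ring]
    cases c <;> exact ih h.2

/-- A `1` on the first inner line below the last diagonal of a zigzag line lies below all its
diagonals. -/
theorem OnesAlong.first_line {Γ : CCFrieze m} {w : List LR} {a : ℤ} (ha : Γ.entry a 1 = 1) :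
    ∀ {i : ℤ} {k : ℕ}, 1 ≤ k → k + w.length ≤ m → Γ.OnesAlong i k w → lastIndex i w ≤ a →
      a + 1 ≤ lastIndex i w + (k + w.length : ℕ) → i ≤ a ∧ a + 1 ≤ i + k := by
  induction w with
  | nil => intro i k _ _ _ h1 h2; exact ⟨h1, by simpa [lastIndex] using h2⟩
  | cons c w ih =>
    intro i k hk hkm h h1 h2
    rw [List.length_cons, show k + (w.length + 1) = k + 1 + w.length by ring] at h2 hkm
    cases c
    · obtain ⟨g1, g2⟩ := ih (by omega) (by omega) h.2 h1 h2
      refine ⟨?_, by push_cast at g2; omega⟩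
      by_contra hlt
      obtain rfl : a = i - 1 := by omega
      refine Γ.not_crossing (i - 1) (p := 1) (q := 2) (r := k + 2) (by omega) (by omega) (by omega)
        (by omega) ha ?_
      rw [show i - 1 + ((1 : ℕ) : ℤ) = i by push_cast; ring]
      exact h.1
    · obtain ⟨g1, g2⟩ := ih (by omega) (by omega) h.2 h1 h2
      refine ⟨g1, ?_⟩
      by_contra hlt
      obtain rfl : a = i + k := by push_cast at g2; omega
      refine Γ.not_crossing i (p := k) (q := k + 1) (r := k + 2) (by omega) (by omega) (by omega)
        (by omega) h.1 ?_
      rw [show k + 2 - k - 1 = 1 by omega]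
      exact ha

theorem entry_add_period (Γ : CCFrieze m) (i : ℤ) (k : ℕ) (hk : k ≤ m + 1) :
    Γ.entry (i + (m + 3)) k = Γ.entry i k := by
  rw [Γ.entry_glide i k hk, Γ.entry_glide _ (m + 1 - k) (by omega),
    show m + 1 - (m + 1 - k) = k by omega]
  congr 1
  push_cast [hk]
  ring

theorem entry_add_mul_period (Γ : CCFrieze m) (i t : ℤ) (k : ℕ) (hk : k ≤ m + 1) :
    Γ.entry (i + t * (m + 3)) k = Γ.entry i k := by
  induction t with
  | zero => simp
  | succ t ih => rw [← ih, ← Γ.entry_add_period (i + t * (m + 3)) k hk]; congr 1; ring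
  | pred t ih =>
    rw [← ih, ← Γ.entry_add_period (i + (-(t : ℤ) - 1) * (m + 3)) k hk]; congr 1; ring

/-- The `1`s on the first inner line of a frieze with a zigzag line are, up to the period, its first
entry and the glide reflection of its last entry. -/
theorem OnesAlong.first_line_eq {Γ : CCFrieze m} {w : List LR} {i a : ℤ} (hw : w.length + 1 = m)
    (h : Γ.OnesAlong i 1 w) (ha : Γ.entry a 1 = 1) :
    ∃ t : ℤ, a + t * (m + 3) = i ∨ a + t * (m + 3) = lastIndex i w + m + 1 := by
  have hlast := h.last
  rw [show 1 + w.length = m by omega] at hlast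
  set c := lastIndex i w with hc
  refine ⟨-((a - c) / (m + 3)), ?_⟩
  have hdm := Int.emod_add_mul_ediv (a - c) (m + 3)
  have hn := Int.emod_nonneg (a - c) (show (m + 3 : ℤ) ≠ 0 by omega)
  have hlt := Int.emod_lt_of_pos (a - c) (show (0 : ℤ) < m + 3 by omega)
  set b : ℤ := a + -((a - c) / (m + 3)) * (m + 3) with hb
  have hb1 : Γ.entry b 1 = 1 := by rw [hb, Γ.entry_add_mul_period _ _ _ (by omega), ha]
  have hbc : b = c + (a - c) % (m + 3) := by rw [hb]; linarith
  have hb0 : c ≤ b := by omega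
  have hb2 : b < c + (m + 3) := by omega
  by_cases h1 : b + 1 ≤ c + m
  · left
    have := h.first_line hb1 le_rfl (by omega) hb0 (by
      rw [show 1 + w.length = m by omega]; exact h1)
    push_cast at this; omega
  by_cases h2 : b = c + m
  · exfalso
    refine Γ.not_crossing c (p := m) (q := m + 1) (r := m + 2) (by omega) (by omega) (by omega)
      (by omega) hlast ?_
    rw [show m + 2 - m - 1 = 1 by omega, ← h2]
    exact hb1
  by_cases h3 : b = c + m + 1
  · exact Or.inr h3
  · exfalso
    have h4 : b = (c - 1) + (m + 3) := by omega
    rw [h4, Γ.entry_add_period _ _ (by omega)] at hb1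
    refine Γ.not_crossing (c - 1) (p := 1) (q := 2) (r := m + 2) (by omega) (by omega) (by omega)
      (by omega) hb1 ?_
    rw [show c - 1 + ((1 : ℕ) : ℤ) = c by push_cast; ring]
    exact hlast

theorem OnesAlong.add_mul_period {Γ : CCFrieze m} {w : List LR} {i : ℤ} {k : ℕ} (t : ℤ)
    (hk : k + w.length ≤ m + 1) (h : Γ.OnesAlong i k w) :
    Γ.OnesAlong (i + t * (m + 3)) k w :=
  h.translate (fun i k hk => (Γ.entry_add_mul_period i t k hk).symm) hk

/-- The zigzag lines of a frieze are all of the same shape, up to reversing the word and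
interchanging its letters. -/
theorem IsGeneratedBy.wordRel {Γ : CCFrieze m} {w w' : List LR} (h : Γ.IsGeneratedBy w)
    (h' : Γ.IsGeneratedBy w') : WordRel w w' := by
  obtain ⟨hw, i, hi⟩ := h
  obtain ⟨hw', i', hi'⟩ := h'
  obtain ⟨t, ht | ht⟩ := hi.first_line_eq hw hi'.head
  · have := hi'.add_mul_period t (by omega)
    rw [ht] at this
    exact Or.inl (hi.unique le_rfl (by omega) (by omega) this)
  · have := hi'.add_mul_period t (by omega)
    rw [ht] at this
    have h2 := hi.reflect_horizontal_full (c := 1) (fun i k hk => Γ.entry_glide i k hk) hw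
    exact Or.inr (Or.inr (Or.inr (h2.unique le_rfl (by simp; omega) (by simp; omega) this)))

end CCFrieze

/-! ### The braid of a rational link in terms of the word -/

/-- The crossings of the rational link diagrams: `L` stands for a crossing at the two middle
positions, `R` for a crossing at the two upper positions. -/
def LR.crossing : LR → Fin 3 × Bool
  | LR.L => (1, true)
  | LR.R => (0, false)

/-- The crossings `Plat.twists`, written as a word. -/
def twistWord : Bool → List ℕ → List LR
  | _, [] => []
  | true, a :: l => List.replicate a LR.L ++ twistWord false l
  | false, a :: l => List.replicate a LR.R ++ twistWord true l

theorem twists_eq_map (s : Bool) (l : List ℕ) :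
    Plat.twists s l = (twistWord s l).map LR.crossing := by
  induction l generalizing s with
  | nil => cases s <;> rfl
  | cons a l ih => cases s <;> simp [Plat.twists, twistWord, ih, LR.crossing]

/-- The value of a braid word, read as a composition of the maps `v ↦ v / (1 + v)` and `v ↦ v + 1`
applied to `0`. For the word of `[0, a₁, …, aₙ]` it is the value of this continued fraction. -/
def braidVal : List LR → ℚ
  | [] => 0
  | LR.L :: t => braidVal t / (1 + braidVal t)
  | LR.R :: t => braidVal t + 1

theorem braidVal_nonneg (t : List LR) : 0 ≤ braidVal t := by
  induction t with
  | nil => exact le_rfl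
  | cons c t ih => cases c <;> simp only [braidVal] <;> positivity

theorem braidVal_append_R_pos (t : List LR) : 0 < braidVal (t ++ [LR.R]) := by
  induction t with
  | nil => norm_num [braidVal]
  | cons c t ih => cases c <;> simp only [braidVal, List.cons_append] <;> positivity

theorem braidVal_L_lt_one (t : List LR) : braidVal (LR.L :: t) < 1 := by
  have := braidVal_nonneg t
  simp only [braidVal]
  rw [div_lt_one (by linarith)]
  linarith

theorem braidVal_append_R_injective {t t' : List LR}
    (h : braidVal (t ++ [LR.R]) = braidVal (t' ++ [LR.R])) : t = t' := by
  induction t generalizing t' with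
  | nil =>
    rcases t' with _ | ⟨_ | _, t'⟩
    · rfl
    · have := braidVal_L_lt_one (t' ++ [LR.R])
      rw [← List.cons_append, ← h] at this
      norm_num [braidVal] at this
    · have := braidVal_append_R_pos t'
      simp only [braidVal, List.cons_append, List.nil_append] at h
      linarith
  | cons c t ih =>
    have h1 := braidVal_append_R_pos t
    rcases t' with _ | ⟨c', t'⟩
    · cases c
      · have := braidVal_L_lt_one (t ++ [LR.R])
        rw [← List.cons_append, h] at this
        norm_num [braidVal] at this
      · simp only [braidVal, List.cons_append, List.nil_append] at h
        linarith
    · have h2 := braidVal_append_R_pos t'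
      cases c <;> cases c'
      · simp only [braidVal, List.cons_append] at h
        rw [div_eq_div_iff (by positivity) (by positivity)] at h
        rw [ih (t' := t') (by linarith)]
      · exfalso
        have := braidVal_L_lt_one (t ++ [LR.R])
        rw [← List.cons_append, h] at this
        simp only [braidVal, List.cons_append] at this
        linarith
      · exfalso
        have := braidVal_L_lt_one (t' ++ [LR.R])
        rw [← List.cons_append, ← h] at this
        simp only [braidVal, List.cons_append] at this
        linarith
      · simp only [braidVal, List.cons_append] at h
        rw [ih (t' := t') (by linarith)]

theorem braidVal_replicate_L (a : ℕ) (t : List LR) :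
    braidVal (List.replicate a LR.L ++ t) = braidVal t / (1 + a * braidVal t) := by
  have h0 := braidVal_nonneg t
  induction a with
  | zero => simp
  | succ a ih =>
    have h1 : 0 < 1 + a * braidVal t := by positivity
    have h2 : 0 < 1 + (a + 1) * braidVal t := by positivity
    simp only [List.replicate_succ, List.cons_append, braidVal, ih]
    push_cast
    field_simp
    ring

theorem braidVal_replicate_R (a : ℕ) (t : List LR) :
    braidVal (List.replicate a LR.R ++ t) = a + braidVal t := by
  induction a with
  | zero => simp
  | succ a ih =>
    simp only [List.replicate_succ, List.cons_append, braidVal, ih]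
    push_cast
    ring

theorem cfValue_nonneg (l : List ℕ) : 0 ≤ cfValue l := by
  induction l with
  | nil => exact le_rfl
  | cons a l ih => simp only [cfValue]; positivity

theorem cfValue_cons_pos {a : ℕ} (ha : 0 < a) (l : List ℕ) : 0 < cfValue (a :: l) := by
  have := cfValue_nonneg l
  simp only [cfValue]
  positivity

theorem braidVal_twistWord (l : List ℕ) (hl : ∀ a ∈ l, 0 < a) :
    (Even l.length → braidVal (twistWord true l) = cfValue l) ∧
    (Odd l.length → braidVal (twistWord false l) = (cfValue l)⁻¹) := by
  induction l with
  | nil => simp [twistWord, braidVal, cfValue]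
  | cons a l ih =>
    obtain ⟨ih1, ih2⟩ := ih fun b hb => hl b (List.mem_cons_of_mem _ hb)
    constructor
    · intro he
      rw [List.length_cons, Nat.even_add_one, Nat.not_even_iff_odd] at he
      rcases l with _ | ⟨b, l⟩
      · simp at he
      have hc := cfValue_cons_pos (hl b (by simp)) l
      rw [twistWord, braidVal_replicate_L, ih2 he]
      change _ = 1 / ((a : ℚ) + cfValue (b :: l))
      generalize cfValue (b :: l) = v at hc
      have : (0 : ℚ) ≤ a := by positivity
      field_simp
      rw [add_comm]
    · intro ho
      rw [List.length_cons, Nat.odd_add_one, Nat.not_odd_iff_even] at ho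
      rw [twistWord, braidVal_replicate_R, ih1 ho, cfValue, one_div, inv_inv]

/-- A braid word ending in `R` consists of twist regions, the last one being of type `R`. -/
theorem exists_twistWord (t : List LR) : ∃ (s : Bool) (a : ℕ) (l : List ℕ), 0 < a ∧
    (∀ b ∈ l, 0 < b) ∧ (s = true ↔ Even (a :: l).length) ∧ twistWord s (a :: l) = t ++ [LR.R] := by
  induction t with
  | nil => exact ⟨false, 1, [], by simp, by simp, by simp, rfl⟩
  | cons c t ih =>
    obtain ⟨s, a, l, ha, hl, hs, ht⟩ := ih
    have hal : ∀ b ∈ a :: l, 0 < b := by simpa using ⟨ha, hl⟩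
    cases c <;> cases s
    · refine ⟨true, 1, a :: l, one_pos, hal, ?_, ?_⟩
      · rw [List.length_cons, Nat.even_add_one]; simpa using hs
      · simp only [twistWord, List.replicate_one] at ht ⊢; simp [ht]
    · exact ⟨true, a + 1, l, by omega, hl, hs, by
        simp only [twistWord, List.replicate_succ] at ht ⊢; simp [ht]⟩
    · exact ⟨false, a + 1, l, by omega, hl, hs, by
        simp only [twistWord, List.replicate_succ] at ht ⊢; simp [ht]⟩
    · refine ⟨false, 1, a :: l, one_pos, hal, ?_, ?_⟩
      · rw [List.length_cons, Nat.even_add_one]; simpa using hs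
      · simp only [twistWord, List.replicate_one] at ht ⊢; simp [ht]

theorem twistWord_eq_append_R (l : List ℕ) (hne : l ≠ []) (hl : ∀ a ∈ l, 0 < a) (s : Bool)
    (hs : s = true ↔ Even l.length) : ∃ t, twistWord s l = t ++ [LR.R] := by
  induction l generalizing s with
  | nil => exact absurd rfl hne
  | cons a l ih =>
    rcases l with _ | ⟨b, l⟩
    · have hs' : s = false := by simpa using hs
      subst hs'
      obtain ⟨a, rfl⟩ := Nat.exists_eq_succ_of_ne_zero (hl a (by simp)).ne'
      exact ⟨List.replicate a LR.R, by simp [twistWord, List.replicate_succ']⟩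
    · have hs' : (!s) = true ↔ Even (b :: l).length := by
        rw [List.length_cons, Nat.even_add_one] at hs
        cases s <;> simpa using hs
      obtain ⟨t, ht⟩ := ih (by simp) (fun c hc => hl c (List.mem_cons_of_mem _ hc)) (!s) hs'
      cases s
      · exact ⟨List.replicate a LR.R ++ t, by rw [twistWord]; simp at ht; simp [ht]⟩
      · exact ⟨List.replicate a LR.L ++ t, by rw [twistWord]; simp at ht; simp [ht]⟩

theorem braidVal_reverse_append (w t : List LR) :
    braidVal (LR.L :: (w.reverse ++ t)) =
      ((wordParents w).2.2.1 * braidVal t + (wordParents w).1) /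
      ((wordParents w).2.2.2 * braidVal t + (wordParents w).2.1) := by
  induction w generalizing t with
  | nil => simp [braidVal, wordParents, add_comm]
  | cons c w ih =>
    rw [List.reverse_cons, List.append_assoc, List.singleton_append, ih]
    have h0 := braidVal_nonneg t
    obtain ⟨h1, h2, h3, -⟩ := wordParents_pos w
    cases c <;> simp only [braidVal, wordParents] <;> push_cast
    · field_simp
      ring
    · congr 1 <;> ring

theorem braidVal_word (w : List LR) : braidVal (LR.L :: (w.reverse ++ [LR.R])) = wordRat w := by
  rw [braidVal_reverse_append, wordRat]
  simp only [braidVal]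
  push_cast
  congr 1 <;> ring

/-- The word of `α` is read off backwards from the diagram `D(T(α))`, up to the first and the last
crossing. -/
theorem rationalBraid_wordRat (w : List LR) :
    rationalBraid (wordRat w) = (LR.L :: (w.reverse ++ [LR.R])).map LR.crossing := by
  have hex : ∃ l, IsEvenExpansion (wordRat w) l := by
    obtain ⟨s, a, l, ha, hl, hs, ht⟩ := exists_twistWord (LR.L :: w.reverse)
    have hal : ∀ b ∈ a :: l, 0 < b := by simpa using ⟨ha, hl⟩
    cases s
    · obtain ⟨a, rfl⟩ := Nat.exists_eq_succ_of_ne_zero ha.ne'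
      simp [twistWord, List.replicate_succ] at ht
    · refine ⟨a :: l, hs.mp rfl, hal, ?_⟩
      rw [← (braidVal_twistWord _ hal).1 (hs.mp rfl), ht, List.cons_append, braidVal_word]
  have hev : IsEvenExpansion (wordRat w) (evenExpansion (wordRat w)) := by
    rw [evenExpansion, dif_pos hex]
    exact hex.choose_spec
  obtain ⟨h1, h2, h3⟩ := hev
  have hne : evenExpansion (wordRat w) ≠ [] := by
    intro h
    rw [h] at h3
    exact (wordRat_pos w).ne h3
  obtain ⟨t, ht⟩ := twistWord_eq_append_R _ hne h2 true (by simpa using h1)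
  have hv := (braidVal_twistWord _ h2).1 h1
  rw [h3, ht, ← braidVal_word, ← List.cons_append] at hv
  rw [rationalBraid, twists_eq_map, ht, braidVal_append_R_injective hv, List.cons_append]

/-! ### Orientations and writhe of a plat diagram -/

namespace Plat

/-- The directions of the four strands behind a crossing, `v` being those in front of it. -/
def permute (v : Fin 4 → ℤˣ) (c : Fin 3 × Bool) : Fin 4 → ℤˣ :=
  fun j => v (Equiv.swap c.1.castSucc c.1.succ j)

/-- The sign of a crossing, `v` being the directions of the four strands in front of it. -/
def sign (v : Fin 4 → ℤˣ) (c : Fin 3 × Bool) : ℤˣ :=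
  if c.2 = true then -(v c.1.castSucc * v c.1.succ) else v c.1.castSucc * v c.1.succ

/-- The sum of the signs of the crossings in a braid, `v` being the directions at its left end. -/
def braidWrithe : (Fin 4 → ℤˣ) → List (Fin 3 × Bool) → ℤ
  | _, [] => 0
  | v, c :: l => sign v c + braidWrithe (permute v c) l

theorem isOrientation_iff {N : ℕ} (b : Fin N → Fin 3 × Bool) (o : Fin (N + 1) × Fin 4 → ℤˣ) :
    (diagram b).IsOrientation o ↔
      (∀ k j, o (k.succ, j) = permute (fun j => o (k.castSucc, j)) (b k) j) ∧
      (o (0, 0) = -o (0, 1) ∧ o (0, 2) = -o (0, 3)) ∧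
      (o (Fin.last N, 0) = -o (Fin.last N, 3) ∧ o (Fin.last N, 1) = -o (Fin.last N, 2)) := by
  have hlocal : ∀ k : Fin N, (∀ j, o (k.succ, j) = permute (fun j => o (k.castSucc, j)) (b k) j) ↔
      o (k.succ, (b k).1.castSucc) = o (k.castSucc, (b k).1.succ) ∧
      o (k.succ, (b k).1.succ) = o (k.castSucc, (b k).1.castSucc) ∧
      ∀ j, j ≠ (b k).1.castSucc → j ≠ (b k).1.succ → o (k.succ, j) = o (k.castSucc, j) := by
    intro k
    constructor
    · intro h
      refine ⟨?_, ?_, fun j h1 h2 => ?_⟩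
      · rw [h, permute, Equiv.swap_apply_left]
      · rw [h, permute, Equiv.swap_apply_right]
      · rw [h, permute, Equiv.swap_apply_of_ne_of_ne h1 h2]
    · rintro ⟨h1, h2, h3⟩ j
      by_cases e1 : j = (b k).1.castSucc
      · rw [e1, h1, permute, Equiv.swap_apply_left]
      by_cases e2 : j = (b k).1.succ
      · rw [e2, h2, permute, Equiv.swap_apply_right]
      · rw [h3 j e1 e2, permute, Equiv.swap_apply_of_ne_of_ne e1 e2]
  simp only [hlocal]
  constructor
  · rintro ⟨h1, h2, h3⟩
    refine ⟨fun k => ?_, ⟨?_, ?_⟩, ?_, ?_⟩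
    · have g2 := h2 k
      have g3 := h3 k
      refine ⟨?_, ?_, fun j e1 e2 => ?_⟩
      · cases hb : (b k).2 <;>
          simp [diagram, corner, hb, LinkDiagram.outward] at g2 g3 <;> assumption
      · cases hb : (b k).2 <;>
          simp [diagram, corner, hb, LinkDiagram.outward] at g2 g3 <;> simp [g2, g3]
      · have := h1 (Sum.inl ⟨(k, j), e1, e2⟩)
        simp [diagram, arcEnd, LinkDiagram.outward] at this
        exact this.symm
    · exact h1 (Sum.inr (Sum.inl false))
    · exact h1 (Sum.inr (Sum.inl true))
    · have := h1 (Sum.inr (Sum.inr false))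
      simpa [diagram, arcEnd, LinkDiagram.outward, neg_eq_iff_eq_neg] using this
    · have := h1 (Sum.inr (Sum.inr true))
      simpa [diagram, arcEnd, LinkDiagram.outward, neg_eq_iff_eq_neg] using this
  · rintro ⟨h, ⟨h1, h2⟩, h3, h4⟩
    refine ⟨?_, fun k => ?_, fun k => ?_⟩
    · rintro (⟨⟨k, j⟩, e1, e2⟩ | (_ | _) | (_ | _))
      · simpa [diagram, arcEnd, LinkDiagram.outward] using ((h k).2.2 j e1 e2).symm
      · exact h1
      · exact h2
      · simpa [diagram, arcEnd, LinkDiagram.outward, neg_eq_iff_eq_neg] using h3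
      · simpa [diagram, arcEnd, LinkDiagram.outward, neg_eq_iff_eq_neg] using h4
    · obtain ⟨g1, g2, -⟩ := h k
      cases hb : (b k).2 <;> simp [diagram, corner, hb, LinkDiagram.outward, g1, g2]
    · obtain ⟨g1, g2, -⟩ := h k
      cases hb : (b k).2 <;> simp [diagram, corner, hb, LinkDiagram.outward, g1, g2]

theorem crossingSign_eq {N : ℕ} {b : Fin N → Fin 3 × Bool} {o : Fin (N + 1) × Fin 4 → ℤˣ}
    (h : (diagram b).IsOrientation o) (k : Fin N) :
    (diagram b).crossingSign o k = sign (fun j => o (k.castSucc, j)) (b k) := by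
  have h := ((isOrientation_iff b o).mp h).1 k (b k).1.castSucc
  rw [permute, Equiv.swap_apply_left] at h
  cases hb : (b k).2 <;>
    simp [LinkDiagram.crossingSign, diagram, corner, hb, sign, LinkDiagram.outward, h, mul_comm]

/-- An orientation is determined by the directions at the left end. -/
theorem orientation_eq_foldl {l : List (Fin 3 × Bool)} {o : Fin (l.length + 1) × Fin 4 → ℤˣ}
    (h : ∀ k j, o (Fin.succ k, j) = permute (fun j => o (k.castSucc, j)) (l.get k) j)
    (k : Fin (l.length + 1)) :
    (fun j => o (k, j)) = (l.take k).foldl permute fun j => o (0, j) := by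
  induction k using Fin.induction with
  | zero => rfl
  | succ k ih =>
    have hk : (k : ℕ) < l.length := k.2
    rw [Fin.val_succ, List.take_add_one, List.getElem?_eq_getElem hk]
    rw [Fin.val_castSucc] at ih
    simp only [Option.toList_some, List.foldl_append, ← ih, List.foldl_cons, List.foldl_nil]
    funext j
    exact h k j

theorem sum_sign_eq (l : List (Fin 3 × Bool)) (v : Fin 4 → ℤˣ) :
    ∑ k : Fin l.length, (sign ((l.take k).foldl permute v) (l.get k) : ℤ) = braidWrithe v l := by
  induction l generalizing v with
  | nil => rfl
  | cons c l ih =>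
    rw [braidWrithe, ← ih]
    exact Fin.sum_univ_succ _

theorem writhe_eq {l : List (Fin 3 × Bool)} {o : Fin (l.length + 1) × Fin 4 → ℤˣ}
    (h : (diagram l.get).IsOrientation o) :
    (diagram l.get).writhe o = braidWrithe (fun j => o (0, j)) l := by
  rw [← sum_sign_eq]
  refine Finset.sum_congr rfl fun k _ => ?_
  rw [crossingSign_eq h, orientation_eq_foldl ((isOrientation_iff _ _).mp h).1]
  rfl

theorem orientation_last {l : List (Fin 3 × Bool)} {o : Fin (l.length + 1) × Fin 4 → ℤˣ}
    (h : (diagram l.get).IsOrientation o) :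
    (fun j => o (Fin.last _, j)) = l.foldl permute fun j => o (0, j) := by
  rw [orientation_eq_foldl ((isOrientation_iff _ _).mp h).1]
  simp

/-- Directions at the left end that fit together with the arcs on the left and, after passing the
braid, with the arcs on the right come from an orientation. -/
theorem exists_orientation (l : List (Fin 3 × Bool)) (v : Fin 4 → ℤˣ)
    (h0 : v 0 = -v 1 ∧ v 2 = -v 3)
    (h1 : l.foldl permute v 0 = -l.foldl permute v 3 ∧
      l.foldl permute v 1 = -l.foldl permute v 2) :
    ∃ o, (diagram l.get).IsOrientation o ∧ ∀ j, o (0, j) = v j := by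
  refine ⟨fun x => (l.take x.1).foldl permute v x.2, (isOrientation_iff _ _).mpr ⟨?_, ?_, ?_⟩,
    fun j => rfl⟩
  · intro k j
    have hk : (k : ℕ) < l.length := k.2
    simp only [Fin.val_succ, List.take_add_one, List.getElem?_eq_getElem hk, Option.toList_some,
      List.foldl_append, List.foldl_cons, List.foldl_nil]
    rfl
  · exact h0
  · simpa using h1

end Plat

/-! ### Orientation types -/

/-- The three ways of orienting two of four strands to the right and two to the left, up to
reversing all of them: in type `t` the strands at the positions `0` and `t + 1` are parallel. -/
def typeVec : Fin 3 → Fin 4 → ℤˣ :=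
  ![![1, 1, -1, -1], ![1, -1, 1, -1], ![1, -1, -1, 1]]

/-- The directions `v` are of type `t`. -/
def HasType (v : Fin 4 → ℤˣ) (t : Fin 3) : Prop := v = typeVec t ∨ v = -typeVec t

/-- The permutation of the orientation types effected by a crossing. -/
def LR.perm : LR → Equiv.Perm (Fin 3)
  | LR.L => Equiv.swap 0 1
  | LR.R => Equiv.swap 1 2

/-- The sign of a crossing, depending on the orientation type in front of it (or behind it). -/
def LR.sign : LR → Fin 3 → ℤ
  | LR.L => ![1, 1, -1]
  | LR.R => ![1, -1, -1]

/-- The permutation of the orientation types effected by a braid. -/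
def wordPerm : List LR → Equiv.Perm (Fin 3)
  | [] => 1
  | c :: u => wordPerm u * c.perm

/-- The sum of the signs of the crossings in a braid, for an orientation of a given type at the left
end. -/
def wordWrithe : List LR → Fin 3 → ℤ
  | [], _ => 0
  | c :: u, t => c.sign t + wordWrithe u (c.perm t)

theorem HasType.permute {v : Fin 4 → ℤˣ} {t : Fin 3} (h : HasType v t) (c : LR) :
    HasType (Plat.permute v c.crossing) (c.perm t) := by
  rcases h with rfl | rfl <;> cases c <;> revert t <;> unfold HasType <;> decide

theorem HasType.sign {v : Fin 4 → ℤˣ} {t : Fin 3} (h : HasType v t) (c : LR) :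
    (Plat.sign v c.crossing : ℤ) = c.sign t := by
  rcases h with rfl | rfl <;> cases c <;> revert t <;> decide

theorem HasType.foldl_permute {v : Fin 4 → ℤˣ} {t : Fin 3} (h : HasType v t) (u : List LR) :
    HasType ((u.map LR.crossing).foldl Plat.permute v) (wordPerm u t) := by
  induction u generalizing v t with
  | nil => exact h
  | cons c u ih => exact ih (h.permute c)

theorem HasType.braidWrithe {v : Fin 4 → ℤˣ} {t : Fin 3} (h : HasType v t) (u : List LR) :
    Plat.braidWrithe v (u.map LR.crossing) = wordWrithe u t := by
  induction u generalizing v t with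
  | nil => rfl
  | cons c u ih =>
    rw [List.map_cons, Plat.braidWrithe, h.sign c, ih (h.permute c), wordWrithe]

/-- The types that fit together with the arcs on the right. -/
theorem HasType.closes {v : Fin 4 → ℤˣ} {t : Fin 3} (h : HasType v t) :
    (v 0 = -v 3 ∧ v 1 = -v 2) ↔ t ≠ 2 := by
  rcases h with rfl | rfl <;> revert t <;> decide

theorem wordPerm_append (u u' : List LR) : wordPerm (u ++ u') = wordPerm u' * wordPerm u := by
  induction u with
  | nil => simp [wordPerm]
  | cons c u ih => simp [wordPerm, ih, mul_assoc]

theorem wordWrithe_append (u u' : List LR) (t : Fin 3) :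
    wordWrithe (u ++ u') t = wordWrithe u t + wordWrithe u' (wordPerm u t) := by
  induction u generalizing t with
  | nil => simp [wordPerm, wordWrithe]
  | cons c u ih => simp [wordPerm, wordWrithe, ih, add_assoc]

theorem wordPerm_reverse (u : List LR) : wordPerm u.reverse = (wordPerm u)⁻¹ := by
  induction u with
  | nil => simp [wordPerm]
  | cons c u ih =>
    have : c.perm⁻¹ = c.perm := by cases c <;> exact Equiv.swap_inv _ _
    rw [List.reverse_cons, wordPerm_append, ih]
    simp [wordPerm, this]

theorem wordWrithe_reverse (u : List LR) (t : Fin 3) :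
    wordWrithe u.reverse (wordPerm u t) = wordWrithe u t := by
  induction u generalizing t with
  | nil => rfl
  | cons c u ih =>
    have h1 : ∀ t, c.sign (c.perm t) = c.sign t := by cases c <;> decide
    rw [List.reverse_cons, wordWrithe_append, wordPerm_reverse]
    simp [wordPerm, wordWrithe, ih, h1, add_comm]

theorem wordPerm_map_swap (u : List LR) (t : Fin 3) :
    wordPerm (u.map LR.swap) t = (wordPerm u t.rev).rev := by
  induction u generalizing t with
  | nil => simp [wordPerm]
  | cons c u ih =>
    have h : ∀ t : Fin 3, (c.swap.perm t).rev = c.perm t.rev := by cases c <;> decide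
    simp [wordPerm, ih, h]

theorem wordWrithe_map_swap (u : List LR) (t : Fin 3) :
    wordWrithe (u.map LR.swap) t = -wordWrithe u t.rev := by
  induction u generalizing t with
  | nil => simp [wordWrithe]
  | cons c u ih =>
    have h : ∀ t : Fin 3, (c.swap.perm t).rev = c.perm t.rev := by cases c <;> decide
    have h' : ∀ t : Fin 3, c.swap.sign t = -c.sign t.rev := by cases c <;> decide
    simp [wordWrithe, ih, h, h', add_comm]

/-- Modulo `2`, the fractions `y / s`, `(x + y) / (r + s)` and `x / r` are `1 / 1`, `1 / 0` and
`0 / 1` in some order, and each letter interchanges two of them like it does with the types. -/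
theorem even_wordParents (w : List LR) :
    (Even (wordParents w).1 ↔ wordPerm w.reverse 2 = 2) ∧
    (Even (wordParents w).2.1 ↔ wordPerm w.reverse 1 = 2) ∧
    (Even (wordParents w).2.2.1 ↔ wordPerm w.reverse 2 = 0) ∧
    (Even (wordParents w).2.2.2 ↔ wordPerm w.reverse 1 = 0) := by
  induction w with
  | nil => simp [wordParents, wordPerm]
  | cons c w ih =>
    obtain ⟨h1, h2, h3, h4⟩ := ih
    rw [List.reverse_cons, wordPerm_append]
    generalize wordPerm w.reverse = P at *
    have key : ∀ t : Fin 3, (Equiv.swap (0 : Fin 3) 1 t = 2 ↔ t = 2) ∧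
        (Equiv.swap (0 : Fin 3) 1 t = 0 ↔ (t = 2 ↔ t = 0)) ∧
        (Equiv.swap (1 : Fin 3) 2 t = 0 ↔ t = 0) ∧
        (Equiv.swap (1 : Fin 3) 2 t = 2 ↔ (t = 2 ↔ t = 0)) := by decide
    cases c <;>
      simp [wordParents, wordPerm, LR.perm, Nat.even_add, h1, h2, h3, h4, key]

theorem even_den_wordRat (w : List LR) : Even (wordRat w).den ↔ wordPerm w.reverse 1 = 1 := by
  obtain ⟨-, h2, -, h4⟩ := even_wordParents w
  rw [(isParents_wordRat w).2.2, Nat.even_add, h2, h4]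
  generalize wordPerm w.reverse 1 = t
  revert t; decide

/-! ### Counting the circles of a state -/

theorem card_quot_eq {X Y : Type*} {r : X → X → Prop} {r' : Y → Y → Prop}
    (f : X → Quot r') (g : Y → Quot r)
    (hf : ∀ x y, r x y → f x = f y) (hg : ∀ x y, r' x y → g x = g y)
    (hgf : ∀ x, Quot.lift g hg (f x) = Quot.mk r x)
    (hfg : ∀ y, Quot.lift f hf (g y) = Quot.mk r' y) :
    Nat.card (Quot r) = Nat.card (Quot r') :=
  Nat.card_congr ⟨Quot.lift f hf, Quot.lift g hg, fun q => Quot.inductionOn q hgf,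
    fun q => Quot.inductionOn q hfg⟩

namespace Plat

/-- The arcs in the strip around a crossing `c` smoothed according to `s`, the points `(false, j)`
lying on the left and `(true, j)` on the right: depending on the kind of the crossing, one of the two
smoothings consists of four horizontal strands, and the other one of two turning arcs and two
horizontal strands. -/
def StripRel (c : Fin 3 × Bool) (s : Bool) (u v : Bool × Fin 4) : Prop :=
  (∃ j, (j ≠ c.1.castSucc ∧ j ≠ c.1.succ ∨ s ≠ c.2) ∧ u = (false, j) ∧ v = (true, j)) ∨
  (s = c.2 ∧ ∃ t, u = (t, c.1.castSucc) ∧ v = (t, c.1.succ))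

/-- The point of a plat diagram corresponding to a point of the strip around the crossing `k`. -/
def stripPoint {N : ℕ} (k : Fin N) (u : Bool × Fin 4) : Fin (N + 1) × Fin 4 :=
  (if u.1 = true then k.succ else k.castSucc, u.2)

/-- The two ways of joining the positions `0, 1, 2, 3` without crossings: the positions `0, 1` and
`2, 3`. Joined positions have the same label. -/
def cupsOuter : Fin 4 → Fin 2 := ![0, 0, 1, 1]

/-- The other way of joining the positions `0, 1, 2, 3` without crossings: the positions `0, 3` and
`1, 2`. -/
def cupsNested : Fin 4 → Fin 2 := ![0, 1, 1, 0]

theorem eq_of_cupsOuter {X : Type*} {f : Fin 4 → X} (h1 : f 0 = f 1) (h2 : f 2 = f 3) {i j : Fin 4}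
    (h : cupsOuter i = cupsOuter j) : f i = f j := by
  fin_cases i <;> fin_cases j <;>
    first | rfl | assumption | (symm; assumption) | exact absurd h (by decide)

theorem eq_of_cupsNested {X : Type*} {f : Fin 4 → X} (h1 : f 0 = f 3) (h2 : f 1 = f 2)
    {i j : Fin 4} (h : cupsNested i = cupsNested j) : f i = f j := by
  fin_cases i <;> fin_cases j <;>
    first | rfl | assumption | (symm; assumption) | exact absurd h (by decide)

theorem diagram_corner {N : ℕ} (b : Fin N → Fin 3 × Bool) : (diagram b).corner = corner b := rfl

/-- The arcs of a state of the closure of a braid, which is closed on the left by joining positions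
with the same label under `p`. -/
def StateRel (p : Fin 4 → Fin 2) {N : ℕ} (b : Fin N → Fin 3 × Bool) (σ : Fin N → Bool)
    (x y : Fin (N + 1) × Fin 4) : Prop :=
  (∃ i j, p i = p j ∧ x = (0, i) ∧ y = (0, j)) ∨
  (∃ k u v, StripRel (b k) (σ k) u v ∧ x = stripPoint k u ∧ y = stripPoint k v) ∨
  (∃ i j, cupsNested i = cupsNested j ∧ x = (Fin.last N, i) ∧ y = (Fin.last N, j))

/-- The number of circles of a state, with the left end closed according to `p`. -/
noncomputable def stateLoops (p : Fin 4 → Fin 2) {N : ℕ} (b : Fin N → Fin 3 × Bool)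
    (σ : Fin N → Bool) : ℕ :=
  Nat.card (Quot (StateRel p b σ))

theorem stateLoops_pos (p : Fin 4 → Fin 2) {N : ℕ} (b : Fin N → Fin 3 × Bool)
    (σ : Fin N → Bool) : 0 < stateLoops p b σ := by
  have : Nonempty (Quot (StateRel p b σ)) := ⟨Quot.mk _ (0, 0)⟩
  exact Nat.card_pos

theorem loops_diagram {N : ℕ} (b : Fin N → Fin 3 × Bool) (σ : Fin N → Bool) :
    (diagram b).loops σ = stateLoops cupsOuter b σ := by
  have hmk : ∀ x y, StateRel cupsOuter b σ x y →
      Quot.mk ((diagram b).Joined σ) x = Quot.mk _ y := by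
    intro x y h
    have sE : ∀ e, Quot.mk ((diagram b).Joined σ) ((diagram b).arcEnd e false).1 =
        Quot.mk _ ((diagram b).arcEnd e true).1 := fun e => Quot.sound (Or.inl ⟨e, rfl, rfl⟩)
    rcases h with ⟨i, j, hij, rfl, rfl⟩ | ⟨k, u, v, h, rfl, rfl⟩ | ⟨i, j, hij, rfl, rfl⟩
    · exact eq_of_cupsOuter (f := fun i => Quot.mk _ (0, i)) (sE (Sum.inr (Sum.inl false)))
        (sE (Sum.inr (Sum.inl true))) hij
    · have s1 : σ k = true →
          Quot.mk ((diagram b).Joined σ) ((diagram b).corner k 0).1 =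
            Quot.mk _ ((diagram b).corner k 1).1 ∧
          Quot.mk ((diagram b).Joined σ) ((diagram b).corner k 2).1 =
            Quot.mk _ ((diagram b).corner k 3).1 := fun hk =>
        ⟨Quot.sound (Or.inr (Or.inl ⟨k, hk, Or.inl ⟨rfl, rfl⟩⟩)),
          Quot.sound (Or.inr (Or.inl ⟨k, hk, Or.inr ⟨rfl, rfl⟩⟩))⟩
      have s2 : σ k = false →
          Quot.mk ((diagram b).Joined σ) ((diagram b).corner k 1).1 =
            Quot.mk _ ((diagram b).corner k 2).1 ∧
          Quot.mk ((diagram b).Joined σ) ((diagram b).corner k 3).1 =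
            Quot.mk _ ((diagram b).corner k 0).1 := fun hk =>
        ⟨Quot.sound (Or.inr (Or.inr ⟨k, hk, Or.inl ⟨rfl, rfl⟩⟩)),
          Quot.sound (Or.inr (Or.inr ⟨k, hk, Or.inr ⟨rfl, rfl⟩⟩))⟩
      rcases h with ⟨j, hj, rfl, rfl⟩ | ⟨hs, t, rfl, rfl⟩
      · by_cases e1 : j = (b k).1.castSucc
        · have hs : σ k ≠ (b k).2 := hj.resolve_left fun h => h.1 e1
          subst e1
          cases hσ : σ k <;> cases hb : (b k).2 <;> rw [hσ, hb] at hs <;>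
            first | exact absurd rfl hs | skip
          · have := s2 hσ
            simp [diagram_corner, corner, hb] at this
            simp [stripPoint, this]
          · have := s1 hσ
            simp [diagram_corner, corner, hb] at this
            simp [stripPoint, this]
        by_cases e2 : j = (b k).1.succ
        · have hs : σ k ≠ (b k).2 := hj.resolve_left fun h => h.2 e2
          subst e2
          cases hσ : σ k <;> cases hb : (b k).2 <;> rw [hσ, hb] at hs <;>
            first | exact absurd rfl hs | skip
          · have := s2 hσ
            simp [diagram_corner, corner, hb] at this
            simp [stripPoint, this]
          · have := s1 hσ
            simp [diagram_corner, corner, hb] at this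
            simp [stripPoint, this]
        · exact sE (Sum.inl ⟨(k, j), e1, e2⟩)
      · cases hσ : σ k <;> rw [hσ] at hs
        · have := s2 hσ
          simp [diagram_corner, corner, ← hs] at this
          cases t <;> simp [stripPoint, this]
        · have := s1 hσ
          simp [diagram_corner, corner, ← hs] at this
          cases t <;> simp [stripPoint, this]
    · exact eq_of_cupsNested (f := fun i => Quot.mk _ (Fin.last N, i))
        (sE (Sum.inr (Sum.inr false))) (sE (Sum.inr (Sum.inr true))) hij
  have hmk' : ∀ x y, (diagram b).Joined σ x y →
      Quot.mk (StateRel cupsOuter b σ) x = Quot.mk _ y := by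
    have hS : ∀ k u v, StripRel (b k) (σ k) u v → Quot.mk (StateRel cupsOuter b σ)
        (stripPoint k u) = Quot.mk _ (stripPoint k v) := fun k u v h =>
      Quot.sound (Or.inr (Or.inl ⟨k, u, v, h, rfl, rfl⟩))
    have hturn : ∀ k, σ k = (b k).2 → ∀ t, Quot.mk (StateRel cupsOuter b σ)
        (stripPoint k (t, (b k).1.castSucc)) = Quot.mk _ (stripPoint k (t, (b k).1.succ)) :=
      fun k hk t => hS _ _ _ (Or.inr ⟨hk, t, rfl, rfl⟩)
    have hstraight : ∀ k, σ k ≠ (b k).2 → ∀ j, Quot.mk (StateRel cupsOuter b σ)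
        (stripPoint k (false, j)) = Quot.mk _ (stripPoint k (true, j)) :=
      fun k hk j => hS _ _ _ (Or.inl ⟨j, Or.inr hk, rfl, rfl⟩)
    rintro x y (⟨e, rfl, rfl⟩ | ⟨k, hk, h⟩ | ⟨k, hk, h⟩)
    · rcases e with ⟨⟨k, j⟩, e1, e2⟩ | (_ | _) | (_ | _)
      · exact hS k (false, j) (true, j) (Or.inl ⟨j, Or.inl ⟨e1, e2⟩, rfl, rfl⟩)
      · exact Quot.sound (Or.inl ⟨0, 1, rfl, rfl, rfl⟩)
      · exact Quot.sound (Or.inl ⟨2, 3, rfl, rfl, rfl⟩)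
      · exact Quot.sound (Or.inr (Or.inr ⟨0, 3, rfl, rfl, rfl⟩))
      · exact Quot.sound (Or.inr (Or.inr ⟨1, 2, rfl, rfl, rfl⟩))
    · cases hb : (b k).2
      · have := hstraight k (by rw [hk, hb]; simp)
        simp [diagram_corner, corner, hb] at h
        simp [stripPoint] at this
        rcases h with ⟨rfl, rfl⟩ | ⟨rfl, rfl⟩ <;> simp [this]
      · have := hturn k (by rw [hk, hb])
        simp [diagram_corner, corner, hb] at h
        simp [stripPoint] at this
        rcases h with ⟨rfl, rfl⟩ | ⟨rfl, rfl⟩ <;> simp [this]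
    · cases hb : (b k).2
      · have := hturn k (by rw [hk, hb])
        simp [diagram_corner, corner, hb] at h
        simp [stripPoint] at this
        rcases h with ⟨rfl, rfl⟩ | ⟨rfl, rfl⟩ <;> simp [this]
      · have := hstraight k (by rw [hk, hb]; simp)
        simp [diagram_corner, corner, hb] at h
        simp [stripPoint] at this
        rcases h with ⟨rfl, rfl⟩ | ⟨rfl, rfl⟩ <;> simp [this]
  exact card_quot_eq (Quot.mk _) (Quot.mk _) hmk' hmk (fun _ => rfl) (fun _ => rfl)

/-- Removing the leftmost crossing from a state. The point `j` at the left end is connected within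
the leftmost strip and the closing arcs to the point `i` on the right of the strip if
`φ j = Sum.inl i`, and lies on the closed circle `e` if `φ j = Sum.inr e`; the points on the right
of the strip are connected in this way as prescribed by `p'`. -/
theorem stateLoops_succ {N : ℕ} (b : Fin (N + 1) → Fin 3 × Bool) (σ : Fin (N + 1) → Bool)
    (p p' : Fin 4 → Fin 2) {E : Type} [Finite E] (φ : Fin 4 → Fin 4 ⊕ E) (ψ : E → Fin 4)
    (hψ : ∀ e, φ (ψ e) = Sum.inr e)
    (hp : ∀ i j, p i = p j → (φ i).map p' id = (φ j).map p' id)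
    (hstrip : ∀ u v, StripRel (b 0) (σ 0) u v →
      (if u.1 = true then Sum.inl (p' u.2) else (φ u.2).map p' id) =
        (if v.1 = true then Sum.inl (p' v.2) else (φ v.2).map p' id))
    (hback : ∀ (X : Type) (f : Bool × Fin 4 → X), (∀ u v, StripRel (b 0) (σ 0) u v → f u = f v) →
      (∀ i j, p i = p j → f (false, i) = f (false, j)) →
      (∀ i j, p' i = p' j → f (true, i) = f (true, j)) ∧
      (∀ j i, φ j = Sum.inl i → f (false, j) = f (true, i)) ∧
      (∀ j e, φ j = Sum.inr e → f (false, j) = f (false, ψ e))) :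
    stateLoops p b σ =
      stateLoops p' (fun k => b k.succ) (fun k => σ k.succ) + Nat.card E := by
  set r := StateRel p b σ with hr
  set r' := StateRel p' (fun k : Fin N => b k.succ) (fun k => σ k.succ) with hr'
  -- labels of points: the component of the smaller state, or the closed circle
  let lab : Fin 4 ⊕ E → Quot r' ⊕ E := Sum.map (fun i => Quot.mk r' (0, i)) id
  have hlab : ∀ a a' : Fin 4 ⊕ E, a.map p' id = a'.map p' id → lab a = lab a' := by
    rintro (i | e) (i' | e') h
    · simp only [Sum.map_inl, Sum.inl.injEq] at h
      exact congrArg Sum.inl (Quot.sound (Or.inl ⟨i, i', h, rfl, rfl⟩))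
    · simp at h
    · simp at h
    · simp only [Sum.map_inr, id, Sum.inr.injEq] at h
      rw [h]
  let F : Fin (N + 1 + 1) × Fin 4 → Quot r' ⊕ E := fun x =>
    Fin.cases (motive := fun _ => Quot r' ⊕ E) (lab (φ x.2)) (fun k => Sum.inl (Quot.mk r' (k, x.2)))
      x.1
  have hF0 : ∀ j, F (0, j) = lab (φ j) := fun j => rfl
  have hFs : ∀ k j, F (Fin.succ k, j) = Sum.inl (Quot.mk r' (k, j)) := fun k j => rfl
  have hF : ∀ x y, r x y → F x = F y := by
    rintro x y (⟨i, j, hij, rfl, rfl⟩ | ⟨k, u, v, h, rfl, rfl⟩ | ⟨i, j, hij, rfl, rfl⟩)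
    · rw [hF0, hF0]
      exact hlab _ _ (hp i j hij)
    · induction k using Fin.cases with
      | zero =>
        have key : ∀ u : Bool × Fin 4, F (stripPoint 0 u) =
            lab (if u.1 = true then Sum.inl u.2 else φ u.2) := by
          rintro ⟨_ | _, j⟩
          · exact hF0 j
          · exact hFs 0 j
        rw [key, key]
        apply hlab
        have := hstrip u v h
        rcases u with ⟨_ | _, j⟩ <;> rcases v with ⟨_ | _, j'⟩ <;> simpa using this
      | succ k =>
        have key : ∀ u : Bool × Fin 4, F (stripPoint k.succ u) =
            Sum.inl (Quot.mk r' (stripPoint k u)) := by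
          rintro ⟨_ | _, j⟩
          · exact hFs k.castSucc j
          · exact hFs k.succ j
        rw [key, key]
        exact congrArg Sum.inl (Quot.sound (Or.inr (Or.inl ⟨k, u, v, h, rfl, rfl⟩)))
    · rw [← Fin.succ_last, hFs, hFs]
      exact congrArg Sum.inl (Quot.sound (Or.inr (Or.inr ⟨i, j, hij, rfl, rfl⟩)))
  obtain ⟨hb1, hb2, hb3⟩ := hback (Quot r) (fun u => Quot.mk r (stripPoint 0 u))
    (fun u v h => Quot.sound (Or.inr (Or.inl ⟨0, u, v, h, rfl, rfl⟩)))
    (fun i j h => Quot.sound (Or.inl ⟨i, j, h, rfl, rfl⟩))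
  let G : Fin (N + 1) × Fin 4 → Quot r := fun x => Quot.mk r (x.1.succ, x.2)
  have hG : ∀ x y, r' x y → G x = G y := by
    rintro x y (⟨i, j, hij, rfl, rfl⟩ | ⟨k, u, v, h, rfl, rfl⟩ | ⟨i, j, hij, rfl, rfl⟩)
    · exact hb1 i j hij
    · have key : ∀ u : Bool × Fin 4, G (stripPoint k u) = Quot.mk r (stripPoint k.succ u) := by
        rintro ⟨_ | _, j⟩ <;> rfl
      rw [key, key]
      exact Quot.sound (Or.inr (Or.inl ⟨k.succ, u, v, h, rfl, rfl⟩))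
    · exact Quot.sound (Or.inr (Or.inr ⟨i, j, hij, rfl, rfl⟩))
  have e : Quot r ≃ Quot r' ⊕ E :=
    { toFun := Quot.lift F hF
      invFun := Sum.elim (Quot.lift G hG) fun e => Quot.mk r (0, ψ e)
      left_inv := by
        rintro ⟨k, j⟩
        induction k using Fin.cases with
        | zero =>
          change Sum.elim _ _ (lab (φ j)) = _
          rcases hj : φ j with i | e
          · exact (hb2 j i hj).symm
          · exact (hb3 j e hj).symm
        | succ k => rfl
      right_inv := by
        rintro (⟨k, j⟩ | e)
        · rfl
        · change lab (φ (ψ e)) = _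
          rw [hψ]
          rfl }
  rw [stateLoops, stateLoops, Nat.card_congr e, Nat.card_sum]

theorem stateLoops_straight {N : ℕ} (b : Fin (N + 1) → Fin 3 × Bool) (σ : Fin (N + 1) → Bool)
    (p : Fin 4 → Fin 2) (h : σ 0 ≠ (b 0).2) :
    stateLoops p b σ = stateLoops p (fun k => b k.succ) (fun k => σ k.succ) := by
  refine (stateLoops_succ b σ p p (E := Empty) Sum.inl Empty.elim (fun e => e.elim) ?_ ?_ ?_).trans
    (by simp)
  · intro i j hij
    simp [hij]
  · rintro u v (⟨j, -, rfl, rfl⟩ | ⟨h', -⟩)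
    · simp
    · exact absurd h' h
  · intro X f hf hp
    have hj : ∀ j, f (false, j) = f (true, j) := fun j => hf _ _ (Or.inl ⟨j, Or.inr h, rfl, rfl⟩)
    exact ⟨fun i j hij => by rw [← hj, ← hj, hp i j hij],
      fun j i hji => by rw [← Sum.inl_injective hji, hj], fun j e => e.elim⟩

theorem stateLoops_middle_outer {N : ℕ} (b : Fin (N + 1) → Fin 3 × Bool)
    (σ : Fin (N + 1) → Bool) (hb : (b 0).1 = 1) (h : σ 0 = (b 0).2) :
    stateLoops cupsOuter b σ =
      stateLoops cupsNested (fun k => b k.succ) (fun k => σ k.succ) := by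
  refine (stateLoops_succ b σ cupsOuter cupsNested (E := Empty)
    ![Sum.inl 0, Sum.inl 0, Sum.inl 3, Sum.inl 3] Empty.elim (fun e => e.elim) ?_ ?_ ?_).trans
    (by simp)
  · decide
  · rintro u v (⟨j, hj, rfl, rfl⟩ | ⟨-, t, rfl, rfl⟩)
    · rw [hb] at hj
      replace hj := hj.resolve_right (fun h' => h' h)
      revert hj j; decide
    · rw [hb]; revert t; decide
  · intro X f hf hp
    have h1 : ∀ t, f (t, 1) = f (t, 2) := fun t =>
      hf _ _ (Or.inr ⟨h, t, by rw [hb]; rfl, by rw [hb]; rfl⟩)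
    have h2 : f (false, 0) = f (true, 0) :=
      hf _ _ (Or.inl ⟨0, Or.inl (by rw [hb]; decide), rfl, rfl⟩)
    have h3 : f (false, 3) = f (true, 3) :=
      hf _ _ (Or.inl ⟨3, Or.inl (by rw [hb]; decide), rfl, rfl⟩)
    have h4 : f (false, 0) = f (false, 1) := hp 0 1 rfl
    have h5 : f (false, 2) = f (false, 3) := hp 2 3 rfl
    have h6 := h1 true
    have h7 := h1 false
    have h8 : f (true, 0) = f (true, 3) := by rw [← h2, h4, h7, h5, h3]
    refine ⟨fun i j hij => ?_, fun j i hji => ?_, fun j e => e.elim⟩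
    · exact eq_of_cupsNested (f := fun i => f (true, i)) h8 h6 hij
    · fin_cases j <;> obtain rfl := Sum.inl_injective hji.symm
      · exact h2
      · exact h4.symm.trans h2
      · exact h5.trans h3
      · exact h3

theorem stateLoops_middle_nested {N : ℕ} (b : Fin (N + 1) → Fin 3 × Bool)
    (σ : Fin (N + 1) → Bool) (hb : (b 0).1 = 1) (h : σ 0 = (b 0).2) :
    stateLoops cupsNested b σ =
      stateLoops cupsNested (fun k => b k.succ) (fun k => σ k.succ) + 1 := by
  refine (stateLoops_succ b σ cupsNested cupsNested (E := Unit)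
    ![Sum.inl 0, Sum.inr (), Sum.inr (), Sum.inl 3] (fun _ => 1) (fun e => rfl) ?_ ?_ ?_).trans
    (by simp)
  · decide
  · rintro u v (⟨j, hj, rfl, rfl⟩ | ⟨-, t, rfl, rfl⟩)
    · rw [hb] at hj
      replace hj := hj.resolve_right (fun h' => h' h)
      revert hj j; decide
    · rw [hb]; revert t; decide
  · intro X f hf hp
    have h1 : ∀ t, f (t, 1) = f (t, 2) := fun t =>
      hf _ _ (Or.inr ⟨h, t, by rw [hb]; rfl, by rw [hb]; rfl⟩)
    have h2 : f (false, 0) = f (true, 0) :=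
      hf _ _ (Or.inl ⟨0, Or.inl (by rw [hb]; decide), rfl, rfl⟩)
    have h3 : f (false, 3) = f (true, 3) :=
      hf _ _ (Or.inl ⟨3, Or.inl (by rw [hb]; decide), rfl, rfl⟩)
    have h4 : f (false, 0) = f (false, 3) := hp 0 3 rfl
    have h6 := h1 true
    have h7 := h1 false
    have h8 : f (true, 0) = f (true, 3) := by rw [← h2, h4, h3]
    refine ⟨fun i j hij => ?_, fun j i hji => ?_, fun j e hje => ?_⟩
    · exact eq_of_cupsNested (f := fun i => f (true, i)) h8 h6 hij
    · fin_cases j <;>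
        first | (obtain rfl := Sum.inl_injective hji.symm; assumption) | simp at hji
    · fin_cases j <;> first | rfl | exact h7.symm | simp at hje

theorem stateLoops_upper_outer {N : ℕ} (b : Fin (N + 1) → Fin 3 × Bool)
    (σ : Fin (N + 1) → Bool) (hb : (b 0).1 = 0) (h : σ 0 = (b 0).2) :
    stateLoops cupsOuter b σ =
      stateLoops cupsOuter (fun k => b k.succ) (fun k => σ k.succ) + 1 := by
  refine (stateLoops_succ b σ cupsOuter cupsOuter (E := Unit)
    ![Sum.inr (), Sum.inr (), Sum.inl 2, Sum.inl 3] (fun _ => 0) (fun e => rfl) ?_ ?_ ?_).trans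
    (by simp)
  · decide
  · rintro u v (⟨j, hj, rfl, rfl⟩ | ⟨-, t, rfl, rfl⟩)
    · rw [hb] at hj
      replace hj := hj.resolve_right (fun h' => h' h)
      revert hj j; decide
    · rw [hb]; revert t; decide
  · intro X f hf hp
    have h1 : ∀ t, f (t, 0) = f (t, 1) := fun t =>
      hf _ _ (Or.inr ⟨h, t, by rw [hb]; rfl, by rw [hb]; rfl⟩)
    have h2 : f (false, 2) = f (true, 2) :=
      hf _ _ (Or.inl ⟨2, Or.inl (by rw [hb]; decide), rfl, rfl⟩)
    have h3 : f (false, 3) = f (true, 3) :=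
      hf _ _ (Or.inl ⟨3, Or.inl (by rw [hb]; decide), rfl, rfl⟩)
    have h4 : f (false, 2) = f (false, 3) := hp 2 3 rfl
    have h6 := h1 true
    have h7 := h1 false
    have h8 : f (true, 2) = f (true, 3) := by rw [← h2, h4, h3]
    refine ⟨fun i j hij => ?_, fun j i hji => ?_, fun j e hje => ?_⟩
    · exact eq_of_cupsOuter (f := fun i => f (true, i)) h6 h8 hij
    · fin_cases j <;>
        first | (obtain rfl := Sum.inl_injective hji.symm; assumption) | simp at hji
    · fin_cases j <;> first | rfl | exact h7.symm | simp at hje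

theorem stateLoops_upper_nested {N : ℕ} (b : Fin (N + 1) → Fin 3 × Bool)
    (σ : Fin (N + 1) → Bool) (hb : (b 0).1 = 0) (h : σ 0 = (b 0).2) :
    stateLoops cupsNested b σ =
      stateLoops cupsOuter (fun k => b k.succ) (fun k => σ k.succ) := by
  refine (stateLoops_succ b σ cupsNested cupsOuter (E := Empty)
    ![Sum.inl 3, Sum.inl 2, Sum.inl 2, Sum.inl 3] Empty.elim (fun e => e.elim) ?_ ?_ ?_).trans
    (by simp)
  · decide
  · rintro u v (⟨j, hj, rfl, rfl⟩ | ⟨-, t, rfl, rfl⟩)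
    · rw [hb] at hj
      replace hj := hj.resolve_right (fun h' => h' h)
      revert hj j; decide
    · rw [hb]; revert t; decide
  · intro X f hf hp
    have h1 : ∀ t, f (t, 0) = f (t, 1) := fun t =>
      hf _ _ (Or.inr ⟨h, t, by rw [hb]; rfl, by rw [hb]; rfl⟩)
    have h2 : f (false, 2) = f (true, 2) :=
      hf _ _ (Or.inl ⟨2, Or.inl (by rw [hb]; decide), rfl, rfl⟩)
    have h3 : f (false, 3) = f (true, 3) :=
      hf _ _ (Or.inl ⟨3, Or.inl (by rw [hb]; decide), rfl, rfl⟩)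
    have h4 : f (false, 0) = f (false, 3) := hp 0 3 rfl
    have h5 : f (false, 1) = f (false, 2) := hp 1 2 rfl
    have h6 := h1 true
    have h7 := h1 false
    have h8 : f (true, 2) = f (true, 3) := by rw [← h2, ← h5, ← h7, h4, h3]
    refine ⟨fun i j hij => ?_, fun j i hji => ?_, fun j e => e.elim⟩
    · exact eq_of_cupsOuter (f := fun i => f (true, i)) h6 h8 hij
    · fin_cases j <;> obtain rfl := Sum.inl_injective hji.symm
      · exact h4.trans h3
      · exact h5.trans h2
      · exact h2
      · exact h3

theorem stateLoops_nil_outer (b : Fin 0 → Fin 3 × Bool) (σ : Fin 0 → Bool) :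
    stateLoops cupsOuter b σ = 1 := by
  rw [stateLoops, Nat.card_eq_one_iff_unique]
  have h1 : Quot.mk (StateRel cupsOuter b σ) (0, 0) = Quot.mk _ (0, 1) :=
    Quot.sound (Or.inl ⟨0, 1, rfl, rfl, rfl⟩)
  have h2 : Quot.mk (StateRel cupsOuter b σ) (0, 2) = Quot.mk _ (0, 3) :=
    Quot.sound (Or.inl ⟨2, 3, rfl, rfl, rfl⟩)
  have h3 : Quot.mk (StateRel cupsOuter b σ) (0, 0) = Quot.mk _ (0, 3) :=
    Quot.sound (Or.inr (Or.inr ⟨0, 3, rfl, rfl, rfl⟩))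
  have h : ∀ q : Quot (StateRel cupsOuter b σ), q = Quot.mk _ (0, 0) := by
    rintro ⟨k, j⟩
    obtain rfl := Subsingleton.elim (α := Fin 1) k 0
    fin_cases j
    · rfl
    · exact h1.symm
    · exact h2.trans h3.symm
    · exact h3.symm
  exact ⟨⟨fun q q' => (h q).trans (h q').symm⟩, ⟨Quot.mk _ (0, 0)⟩⟩

theorem stateLoops_nil_nested (b : Fin 0 → Fin 3 × Bool) (σ : Fin 0 → Bool) :
    stateLoops cupsNested b σ = 2 := by
  have hf : ∀ x y, StateRel cupsNested b σ x y → cupsNested x.2 = cupsNested y.2 := by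
    rintro x y (⟨i, j, hij, rfl, rfl⟩ | ⟨k, -⟩ | ⟨i, j, hij, rfl, rfl⟩)
    · exact hij
    · exact k.elim0
    · exact hij
  have : Function.Bijective (Quot.lift (fun x : Fin 1 × Fin 4 => cupsNested x.2) hf) := by
    constructor
    · rintro ⟨k, j⟩ ⟨k', j'⟩ h
      obtain rfl := Subsingleton.elim (α := Fin 1) k 0
      obtain rfl := Subsingleton.elim (α := Fin 1) k' 0
      exact Quot.sound (Or.inl ⟨j, j', h, rfl, rfl⟩)
    · intro t
      fin_cases t
      · exact ⟨Quot.mk _ (0, 0), rfl⟩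
      · exact ⟨Quot.mk _ (0, 1), rfl⟩
  rw [stateLoops, Nat.card_eq_of_bijective _ this, Nat.card_eq_fintype_card, Fintype.card_fin]

end Plat

/-! ### The Kauffman bracket as a product of transfer matrices -/

/-- The value `-A² - A⁻²` of an additional circle. -/
noncomputable def circleVal : ℤ[T;T⁻¹] := -LaurentPolynomial.T 2 - LaurentPolynomial.T (-2)

namespace Plat

/-- The Kauffman bracket of the closure of a braid that is closed on the left according to `p`. -/
noncomputable def closedBracket (p : Fin 4 → Fin 2) {N : ℕ} (b : Fin N → Fin 3 × Bool) : ℤ[T;T⁻¹] :=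
  ∑ σ : Fin N → Bool,
    (∏ k, LaurentPolynomial.T (if σ k = true then (1 : ℤ) else -1)) *
      circleVal ^ (stateLoops p b σ - 1)

theorem bracket_diagram {N : ℕ} (b : Fin N → Fin 3 × Bool) :
    (diagram b).bracket = closedBracket cupsOuter b := by
  simp only [LinkDiagram.bracket, closedBracket, loops_diagram, circleVal]

theorem closedBracket_nil_outer (b : Fin 0 → Fin 3 × Bool) : closedBracket cupsOuter b = 1 := by
  rw [closedBracket, Fintype.sum_unique, stateLoops_nil_outer]
  simp

theorem closedBracket_nil_nested (b : Fin 0 → Fin 3 × Bool) :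
    closedBracket cupsNested b = circleVal := by
  rw [closedBracket, Fintype.sum_unique, stateLoops_nil_nested]
  simp

/-- Expansion of the bracket at the leftmost crossing, if its two smoothings replace the arcs on the
left by `p₁`, `p₂` and split off `n₁`, `n₂` circles. -/
theorem closedBracket_succ (p p₁ p₂ : Fin 4 → Fin 2) (n₁ n₂ : ℕ) {N : ℕ}
    (b : Fin (N + 1) → Fin 3 × Bool)
    (h₁ : ∀ σ : Fin (N + 1) → Bool, σ 0 = true → stateLoops p b σ =
      stateLoops p₁ (fun k => b k.succ) (fun k => σ k.succ) + n₁)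
    (h₂ : ∀ σ : Fin (N + 1) → Bool, σ 0 = false → stateLoops p b σ =
      stateLoops p₂ (fun k => b k.succ) (fun k => σ k.succ) + n₂) :
    closedBracket p b =
      LaurentPolynomial.T 1 * circleVal ^ n₁ * closedBracket p₁ (fun k => b k.succ) +
      LaurentPolynomial.T (-1) * circleVal ^ n₂ * closedBracket p₂ (fun k => b k.succ) := by
  unfold closedBracket
  rw [← (Fin.consEquiv fun _ => Bool).sum_comp, Fintype.sum_prod_type, Fintype.sum_bool,
    Finset.mul_sum, Finset.mul_sum]
  congr 1
  · refine Finset.sum_congr rfl fun σ _ => ?_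
    have hpos := stateLoops_pos p₁ (fun k => b k.succ) σ
    have h := h₁ (Fin.consEquiv (fun _ => Bool) (true, σ)) rfl
    simp only [Fin.consEquiv_apply, Fin.cons_succ] at h
    rw [Fin.prod_univ_succ]
    simp only [Fin.consEquiv_apply, Fin.cons_zero, Fin.cons_succ, if_true]
    rw [h, Nat.sub_add_comm hpos, pow_add]
    ring
  · refine Finset.sum_congr rfl fun σ _ => ?_
    have hpos := stateLoops_pos p₂ (fun k => b k.succ) σ
    have h := h₂ (Fin.consEquiv (fun _ => Bool) (false, σ)) rfl
    simp only [Fin.consEquiv_apply, Fin.cons_succ] at h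
    rw [Fin.prod_univ_succ]
    simp only [Fin.consEquiv_apply, Fin.cons_zero, Fin.cons_succ, Bool.false_eq_true, if_false]
    rw [h, Nat.sub_add_comm hpos, pow_add]
    ring

end Plat

/-- The effect of a crossing on a linear combination `v.1 • a + v.2 • b`, where `a` stands for the arcs
joining the positions `0, 1` and `2, 3`, and `b` for those joining `0, 3` and `1, 2`. -/
noncomputable def LR.transfer (v : ℤ[T;T⁻¹] × ℤ[T;T⁻¹]) : LR → ℤ[T;T⁻¹] × ℤ[T;T⁻¹]
  | LR.L => (LaurentPolynomial.T (-1) * v.1, LaurentPolynomial.T 1 * v.1 +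
      (LaurentPolynomial.T (-1) + LaurentPolynomial.T 1 * circleVal) * v.2)
  | LR.R => ((LaurentPolynomial.T 1 + LaurentPolynomial.T (-1) * circleVal) * v.1 +
      LaurentPolynomial.T (-1) * v.2, LaurentPolynomial.T 1 * v.2)

/-- The bilinear form counting the circles obtained by gluing two pairs of arcs: two circles for equal
pairs, one circle for different pairs, where the first circle has the value `1`. -/
noncomputable def gluing (v v' : ℤ[T;T⁻¹] × ℤ[T;T⁻¹]) : ℤ[T;T⁻¹] :=
  circleVal * (v.1 * v'.1 + v.2 * v'.2) + (v.1 * v'.2 + v.2 * v'.1)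

open Plat in
theorem closedBracket_eq_gluing (u : List LR) (v : ℤ[T;T⁻¹] × ℤ[T;T⁻¹]) :
    v.1 * closedBracket cupsOuter (u.map LR.crossing).get +
      v.2 * closedBracket cupsNested (u.map LR.crossing).get =
    gluing (0, 1) (u.foldl LR.transfer v) := by
  induction u generalizing v with
  | nil =>
    have h1 := closedBracket_nil_outer (([] : List LR).map LR.crossing).get
    have h2 := closedBracket_nil_nested (([] : List LR).map LR.crossing).get
    rw [h1, h2]
    simp only [gluing, List.foldl_nil]
    ring
  | cons c u ih =>
    rw [List.foldl_cons, ← ih]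
    cases c
    · have h1 := closedBracket_succ cupsOuter cupsNested cupsOuter 0 0
        ((LR.L :: u).map LR.crossing).get
        (fun σ h => stateLoops_middle_outer _ σ rfl h)
        (fun σ h => stateLoops_straight _ σ _ (by rw [h]; exact Bool.false_ne_true))
      have h2 := closedBracket_succ cupsNested cupsNested cupsNested 1 0
        ((LR.L :: u).map LR.crossing).get
        (fun σ h => stateLoops_middle_nested _ σ rfl h)
        (fun σ h => stateLoops_straight _ σ _ (by rw [h]; exact Bool.false_ne_true))
      rw [h1, h2]
      change _ = LaurentPolynomial.T (-1) * v.1 *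
          closedBracket cupsOuter (fun k => ((LR.L :: u).map LR.crossing).get (Fin.succ k)) +
        (LaurentPolynomial.T 1 * v.1 + (LaurentPolynomial.T (-1) +
          LaurentPolynomial.T 1 * circleVal) * v.2) *
          closedBracket cupsNested (fun k => ((LR.L :: u).map LR.crossing).get (Fin.succ k))
      ring
    · have h1 := closedBracket_succ cupsOuter cupsOuter cupsOuter 0 1
        ((LR.R :: u).map LR.crossing).get
        (fun σ h => stateLoops_straight _ σ _ (by rw [h]; exact Bool.false_ne_true.symm))
        (fun σ h => stateLoops_upper_outer _ σ rfl h)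
      have h2 := closedBracket_succ cupsNested cupsNested cupsOuter 0 0
        ((LR.R :: u).map LR.crossing).get
        (fun σ h => stateLoops_straight _ σ _ (by rw [h]; exact Bool.false_ne_true.symm))
        (fun σ h => stateLoops_upper_nested _ σ rfl h)
      rw [h1, h2]
      change _ = ((LaurentPolynomial.T 1 + LaurentPolynomial.T (-1) * circleVal) * v.1 +
          LaurentPolynomial.T (-1) * v.2) *
          closedBracket cupsOuter (fun k => ((LR.R :: u).map LR.crossing).get (Fin.succ k)) +
        LaurentPolynomial.T 1 * v.2 *
          closedBracket cupsNested (fun k => ((LR.R :: u).map LR.crossing).get (Fin.succ k))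
      ring

/-- The combination of arcs obtained from the first crossing of `D(T(α))` and the arcs on the left;
it is also obtained from the last crossing and the arcs on the right. -/
noncomputable def endVec : ℤ[T;T⁻¹] × ℤ[T;T⁻¹] :=
  (LaurentPolynomial.T (-1), LaurentPolynomial.T 1)

/-- The Kauffman bracket of the diagram whose crossings are `L`, `u`, `R`. -/
noncomputable def wordBracket (u : List LR) : ℤ[T;T⁻¹] :=
  gluing endVec (u.foldl LR.transfer endVec)

theorem gluing_comm (v v' : ℤ[T;T⁻¹] × ℤ[T;T⁻¹]) : gluing v v' = gluing v' v := by
  simp only [gluing]; ring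

theorem gluing_transfer (v v' : ℤ[T;T⁻¹] × ℤ[T;T⁻¹]) (c : LR) :
    gluing (LR.transfer v c) v' = gluing v (LR.transfer v' c) := by
  cases c <;> simp only [gluing, LR.transfer] <;> ring

theorem gluing_foldl_transfer (v v' : ℤ[T;T⁻¹] × ℤ[T;T⁻¹]) (u : List LR) :
    gluing (u.foldl LR.transfer v) v' = gluing v (u.reverse.foldl LR.transfer v') := by
  induction u generalizing v with
  | nil => rfl
  | cons c u ih =>
    rw [List.foldl_cons, ih, gluing_transfer, List.reverse_cons, List.foldl_append]
    rfl

theorem bracket_word (u : List LR) :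
    (Plat.diagram ((LR.L :: (u ++ [LR.R])).map LR.crossing).get).bracket = wordBracket u := by
  have h := closedBracket_eq_gluing (LR.L :: (u ++ [LR.R])) (1, 0)
  rw [one_mul, zero_mul, add_zero] at h
  have h1 : LR.transfer (1, 0) LR.L = endVec := by simp [LR.transfer, endVec]
  have h2 : LR.transfer (0, 1) LR.R = endVec := by simp [LR.transfer, endVec]
  rw [Plat.bracket_diagram, h, List.foldl_cons, List.foldl_append, List.foldl_cons, List.foldl_nil,
    ← gluing_transfer, h1, h2, wordBracket]

theorem wordBracket_reverse (u : List LR) : wordBracket u.reverse = wordBracket u := by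
  rw [wordBracket, ← gluing_foldl_transfer, gluing_comm, wordBracket]

/-- The substitution `A ↦ A⁻¹` combined with the exchange of the two pairs of arcs. -/
noncomputable def mirrorVec (v : ℤ[T;T⁻¹] × ℤ[T;T⁻¹]) : ℤ[T;T⁻¹] × ℤ[T;T⁻¹] :=
  (LaurentPolynomial.invert v.2, LaurentPolynomial.invert v.1)

theorem invert_circleVal : LaurentPolynomial.invert circleVal = circleVal := by
  simp [circleVal, LaurentPolynomial.invert_T]
  ring

theorem invert_gluing (v v' : ℤ[T;T⁻¹] × ℤ[T;T⁻¹]) :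
    LaurentPolynomial.invert (gluing v v') = gluing (mirrorVec v) (mirrorVec v') := by
  simp only [gluing, mirrorVec, map_add, map_mul, invert_circleVal]
  ring

theorem mirrorVec_transfer (v : ℤ[T;T⁻¹] × ℤ[T;T⁻¹]) (c : LR) :
    mirrorVec (LR.transfer v c) = LR.transfer (mirrorVec v) c.swap := by
  cases c <;> ext1 <;>
    simp [mirrorVec, LR.transfer, LR.swap, invert_circleVal, LaurentPolynomial.invert_T, add_comm]

theorem mirrorVec_foldl_transfer (v : ℤ[T;T⁻¹] × ℤ[T;T⁻¹]) (u : List LR) :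
    mirrorVec (u.foldl LR.transfer v) = (u.map LR.swap).foldl LR.transfer (mirrorVec v) := by
  induction u generalizing v with
  | nil => rfl
  | cons c u ih => simp [ih, mirrorVec_transfer]

theorem wordBracket_map_swap (u : List LR) :
    wordBracket (u.map LR.swap) = LaurentPolynomial.invert (wordBracket u) := by
  have h : mirrorVec endVec = endVec := by simp [mirrorVec, endVec, LaurentPolynomial.invert_T]
  rw [wordBracket, wordBracket, invert_gluing, mirrorVec_foldl_transfer, h]

/-! ### The substitution `t = A⁻⁴` -/

/-- `substHalf` as a ring homomorphism. -/
noncomputable def substHalfHom : ℤ[T;T⁻¹] →+* ℤ[T;T⁻¹] :=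
  AddMonoidAlgebra.mapDomainRingHom ℤ (AddMonoidHom.mulLeft (-2 : ℤ))

theorem substHalfHom_apply (g : ℤ[T;T⁻¹]) : substHalfHom g = substHalf g := rfl

theorem substHalf_injective : Function.Injective substHalf :=
  AddMonoidAlgebra.mapDomain_injective fun a b h => by simpa using h

theorem substHalfHom_T (n : ℤ) :
    substHalfHom (LaurentPolynomial.T n) = LaurentPolynomial.T (-2 * n) := by
  rw [substHalfHom_apply, substHalf, LaurentPolynomial.T, AddMonoidAlgebra.mapDomain_single]
  rfl

theorem substHalfHom_C (n : ℤ) :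
    substHalfHom (LaurentPolynomial.C n) = LaurentPolynomial.C n := by
  simp

/-- All exponents of `f` have the same parity as `n`. -/
def HasParity (n : ℤ) (f : ℤ[T;T⁻¹]) : Prop :=
  ∃ g, f = LaurentPolynomial.T n * substHalfHom g

theorem HasParity.add {n : ℤ} {f g : ℤ[T;T⁻¹]} (hf : HasParity n f) (hg : HasParity n g) :
    HasParity n (f + g) := by
  obtain ⟨f, rfl⟩ := hf
  obtain ⟨g, rfl⟩ := hg
  exact ⟨f + g, by rw [map_add, mul_add]⟩

theorem HasParity.mul {n k : ℤ} {f g : ℤ[T;T⁻¹]} (hf : HasParity n f) (hg : HasParity k g) :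
    HasParity (n + k) (f * g) := by
  obtain ⟨f, rfl⟩ := hf
  obtain ⟨g, rfl⟩ := hg
  exact ⟨f * g, by rw [map_mul, LaurentPolynomial.T_add]; ring⟩

theorem hasParity_T (n : ℤ) : HasParity n (LaurentPolynomial.T n) := ⟨1, by simp⟩

theorem HasParity.of_even {n k : ℤ} {f : ℤ[T;T⁻¹]} (hf : HasParity n f) (h : Even (n - k)) :
    HasParity k f := by
  obtain ⟨f, rfl⟩ := hf
  obtain ⟨j, hj⟩ := h
  refine ⟨LaurentPolynomial.T (-j) * f, ?_⟩
  rw [map_mul, substHalfHom_T, ← mul_assoc, ← LaurentPolynomial.T_add]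
  congr 2
  omega

theorem hasParity_circleVal : HasParity 0 circleVal := by
  refine ⟨-LaurentPolynomial.T (-1) - LaurentPolynomial.T 1, ?_⟩
  simp [circleVal, substHalfHom_T]

theorem hasParity_foldl_transfer (u : List LR) {n : ℤ} {v : ℤ[T;T⁻¹] × ℤ[T;T⁻¹]}
    (h : HasParity n v.1 ∧ HasParity n v.2) :
    HasParity (n + u.length) (u.foldl LR.transfer v).1 ∧
      HasParity (n + u.length) (u.foldl LR.transfer v).2 := by
  induction u generalizing n v with
  | nil => simpa using h
  | cons c u ih =>
    have hA : ∀ {f}, HasParity n f → HasParity (n + 1) (LaurentPolynomial.T 1 * f) := fun hf =>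
      ((hasParity_T 1).mul hf).of_even ⟨0, by ring⟩
    have hB : ∀ {f}, HasParity n f → HasParity (n + 1) (LaurentPolynomial.T (-1) * f) := fun hf =>
      ((hasParity_T (-1)).mul hf).of_even ⟨-1, by ring⟩
    have hδ : ∀ {f}, HasParity n f → HasParity n (circleVal * f) := fun hf =>
      (hasParity_circleVal.mul hf).of_even ⟨0, by ring⟩
    have key : HasParity (n + 1) (LR.transfer v c).1 ∧ HasParity (n + 1) (LR.transfer v c).2 := by
      cases c
      · refine ⟨hB h.1, (hA h.1).add ?_⟩
        rw [add_mul, mul_assoc]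
        exact (hB h.2).add (hA (hδ h.2))
      · refine ⟨HasParity.add ?_ (hB h.2), hA h.2⟩
        rw [add_mul, mul_assoc]
        exact (hA h.1).add (hB (hδ h.1))
    have := ih key
    rw [List.foldl_cons, List.length_cons]
    push_cast
    rwa [show n + ((u.length : ℤ) + 1) = n + 1 + u.length by ring]

theorem hasParity_wordBracket (u : List LR) : HasParity u.length (wordBracket u) := by
  have h0 : HasParity 1 endVec.1 ∧ HasParity 1 endVec.2 :=
    ⟨(hasParity_T (-1)).of_even ⟨-1, by ring⟩, hasParity_T 1⟩
  obtain ⟨h1, h2⟩ := hasParity_foldl_transfer u h0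
  have g := (hasParity_circleVal.mul ((h0.1.mul h1).add (h0.2.mul h2))).of_even
    (k := u.length) ⟨1, by ring⟩
  have g' := ((h0.1.mul h2).add (h0.2.mul h1)).of_even (k := u.length) ⟨1, by ring⟩
  exact g.add g'

theorem hasParity_negCube (n : ℤ) : HasParity n (LinkDiagram.negCube n) := by
  have : HasParity (3 * n) (LinkDiagram.negCube n) :=
    ⟨LaurentPolynomial.C (n.negOnePow : ℤ), by rw [substHalfHom_C, mul_comm]; rfl⟩
  exact this.of_even ⟨n, by ring⟩

/-! ### The Jones polynomial in terms of the word -/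

/-- The writhe of the diagram whose crossings are `L`, `u`, `R`, for an orientation of type `s` behind
the first crossing. -/
def linkWrithe (u : List LR) (s : Fin 3) : ℤ :=
  LR.L.sign s + wordWrithe u s + LR.R.sign (wordPerm u s)

/-- `s` is the type, behind the first crossing, of the orientation chosen on the diagram whose crossings
are `L`, `u`, `R`: it fits together with the arcs on the left and on the right, and `s = 0` if there are
two components, that is, if the arcs admit both `0` and `2`. -/
def IsStartType (u : List LR) (s : Fin 3) : Prop :=
  s ≠ 1 ∧ wordPerm u s ≠ 1 ∧ (wordPerm u 1 = 1 → s = 0)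

theorem exists_isStartType (u : List LR) : ∃ s, IsStartType u s := by
  unfold IsStartType
  generalize wordPerm u = P
  revert P; decide

theorem IsStartType.unique {u : List LR} {s s' : Fin 3} (h : IsStartType u s)
    (h' : IsStartType u s') : s = s' := by
  unfold IsStartType at h h'
  generalize wordPerm u = P at *
  revert P s s'; decide

theorem linkWrithe_perm_L (u : List LR) (s : Fin 3) :
    wordWrithe (LR.L :: (u ++ [LR.R])) (LR.L.perm s) = linkWrithe u s := by
  have h1 : ∀ s, LR.L.sign (LR.L.perm s) = LR.L.sign s := by decide
  have h2 : ∀ s, LR.L.perm (LR.L.perm s) = s := by decide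
  simp only [wordWrithe, wordWrithe_append, h1, h2, linkWrithe]
  ring

theorem wordPerm_perm_L (u : List LR) (s : Fin 3) :
    wordPerm (LR.L :: (u ++ [LR.R])) (LR.L.perm s) = LR.R.perm (wordPerm u s) := by
  have h2 : ∀ s, LR.L.perm (LR.L.perm s) = s := by decide
  simp [wordPerm, wordPerm_append, h2]

theorem typeVec_perm_L {v : Fin 4 → ℤˣ} (h0 : v 0 = 1) (h1 : v 0 = -v 1) (h2 : v 2 = -v 3) :
    ∃ s, s ≠ 1 ∧ v = typeVec (LR.L.perm s) ∧ (v 1 = -v 2 → s = 0) := by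
  have h3 : v 3 = -v 2 := by rw [h2, neg_neg]
  have h4 : v 1 = -1 := by rw [← h0, h1, neg_neg]
  rcases Int.units_eq_one_or (v 2) with h | h
  · refine ⟨0, by decide, ?_, fun _ => rfl⟩
    funext j
    fin_cases j
    · exact h0
    · exact h4
    · exact h
    · exact h3.trans (by rw [h]; rfl)
  · refine ⟨2, by decide, ?_, fun hv => ?_⟩
    · funext j
      fin_cases j
      · exact h0
      · exact h4
      · exact h
      · exact h3.trans (by rw [h]; rfl)
    · rw [h4, h] at hv
      exact absurd hv (by decide)

theorem IsStandardOrientation.jones_eq {w : List LR}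
    {o : Fin ((rationalBraid (wordRat w)).length + 1) × Fin 4 → ℤˣ}
    (h : IsStandardOrientation (wordRat w) o) : ∃ s, IsStartType w.reverse s ∧
      (rationalLink (wordRat w)).jones o =
        LinkDiagram.negCube (-linkWrithe w.reverse s) * wordBracket w.reverse := by
  obtain ⟨ho, h0, heven⟩ := h
  obtain ⟨-, ⟨h1, h2⟩, h3⟩ := (Plat.isOrientation_iff _ o).mp ho
  obtain ⟨s, hs1, hs2, hs3⟩ := typeVec_perm_L (v := fun j => o (0, j)) h0 h1 h2
  have hend := Plat.orientation_last ho
  have hw := Plat.writhe_eq ho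
  have hbr : (Plat.diagram (rationalBraid (wordRat w)).get).bracket = wordBracket w.reverse := by
    rw [rationalBraid_wordRat, bracket_word]
  have hst : HasType (typeVec (LR.L.perm s)) (LR.L.perm s) := Or.inl rfl
  rw [hs2] at hend hw
  have hval : Plat.braidWrithe (typeVec (LR.L.perm s)) (rationalBraid (wordRat w)) =
      linkWrithe w.reverse s := by
    rw [rationalBraid_wordRat, hst.braidWrithe, linkWrithe_perm_L]
  have hclose : ((fun j => o (Fin.last _, j)) 0 = -(fun j => o (Fin.last _, j)) 3 ∧
      (fun j => o (Fin.last _, j)) 1 = -(fun j => o (Fin.last _, j)) 2) := h3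
  rw [hend] at hclose
  rw [rationalBraid_wordRat, (hst.foldl_permute _).closes, wordPerm_perm_L] at hclose
  refine ⟨s, ⟨hs1, ?_, fun h => hs3 (heven ((even_den_wordRat w).mpr h))⟩, ?_⟩
  · rintro h
    rw [h] at hclose
    exact hclose rfl
  · have hw' : (rationalLink (wordRat w)).writhe o = linkWrithe w.reverse s :=
      hw.trans hval
    have hbr' : (rationalLink (wordRat w)).bracket = wordBracket w.reverse := hbr
    rw [LinkDiagram.jones, hw', hbr']

theorem exists_isStandardOrientation (w : List LR) :
    ∃ o, IsStandardOrientation (wordRat w) o := by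
  obtain ⟨s, hs1, hs2, hs3⟩ := exists_isStartType w.reverse
  have hst : HasType (typeVec (LR.L.perm s)) (LR.L.perm s) := Or.inl rfl
  have key : typeVec (LR.L.perm s) 0 = -typeVec (LR.L.perm s) 1 ∧
      typeVec (LR.L.perm s) 2 = -typeVec (LR.L.perm s) 3 := by
    revert hs1; clear * -; revert s; decide
  obtain ⟨o, ho, hv⟩ := Plat.exists_orientation (rationalBraid (wordRat w))
    (typeVec (LR.L.perm s)) key (by
      rw [rationalBraid_wordRat, (hst.foldl_permute _).closes, wordPerm_perm_L]
      intro h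
      apply hs2
      generalize wordPerm w.reverse s = t at h
      revert t; decide)
  refine ⟨o, ho, ?_, fun he => ?_⟩
  · rw [hv]
    clear * - ; revert s; decide
  · rw [hv, hv, hs3 ((even_den_wordRat w).mp he)]
    decide

/-- The Jones polynomial of `D(T(α))` in terms of the word of `α`. -/
theorem jonesV_wordRat {w : List LR} {s : Fin 3} (hs : IsStartType w.reverse s) :
    jonesV (wordRat w) =
      LinkDiagram.negCube (-linkWrithe w.reverse s) * wordBracket w.reverse := by
  have hex := exists_isStandardOrientation w
  rw [jonesV, dif_pos hex]
  obtain ⟨s', hs', h⟩ := hex.choose_spec.jones_eq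
  rw [h, hs.unique hs']

theorem even_linkWrithe (u : List LR) (s : Fin 3) : Even (linkWrithe u s - u.length) := by
  have hodd : ∀ (c : LR) (t : Fin 3), Odd (c.sign t) := by
    intro c t
    rw [← Int.not_even_iff_odd]
    revert t
    cases c <;> decide
  have h : Even (wordWrithe u s - u.length) := by
    induction u generalizing s with
    | nil => simp [wordWrithe]
    | cons c u ih =>
      have := ((hodd c s).sub_odd odd_one).add (ih (c.perm s))
      rw [wordWrithe, List.length_cons]
      push_cast
      rwa [show c.sign s + wordWrithe u (c.perm s) - ((u.length : ℤ) + 1) =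
        c.sign s - 1 + (wordWrithe u (c.perm s) - u.length) by ring]
  have := h.add ((hodd LR.L s).add_odd (hodd LR.R (wordPerm u s)))
  rw [linkWrithe]
  rwa [show LR.L.sign s + wordWrithe u s + LR.R.sign (wordPerm u s) - (u.length : ℤ) =
    wordWrithe u s - u.length + (LR.L.sign s + LR.R.sign (wordPerm u s)) by ring]

/-- The Jones polynomial is a Laurent polynomial in `t^{1/2} = A⁻²`. -/
theorem jonesV_mem_range (w : List LR) : jonesV (wordRat w) ∈ Set.range substHalf := by
  obtain ⟨s, hs⟩ := exists_isStartType w.reverse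
  rw [jonesV_wordRat hs]
  have h := ((hasParity_negCube (-linkWrithe w.reverse s)).mul
    (hasParity_wordBracket w.reverse)).of_even (k := 0) (by
      have := (even_linkWrithe w.reverse s).neg
      rw [neg_sub] at this
      rwa [sub_zero, neg_add_eq_sub])
  obtain ⟨g, hg⟩ := h
  exact ⟨g, by rw [hg, LaurentPolynomial.T_zero, one_mul]; rfl⟩

theorem invert_mem_range {f : ℤ[T;T⁻¹]} (hf : f ∈ Set.range substHalf) :
    LaurentPolynomial.invert f ∈ Set.range substHalf := by
  obtain ⟨g, rfl⟩ := hf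
  refine ⟨LaurentPolynomial.invert g, ?_⟩
  rw [← substHalfHom_apply, ← substHalfHom_apply]
  induction g using LaurentPolynomial.induction_on' with
  | add p q hp hq => rw [map_add, map_add, map_add, map_add, hp, hq]
  | C_mul_T n a =>
    simp only [map_mul, substHalfHom_T, LaurentPolynomial.invert_T, LaurentPolynomial.invert_C,
      substHalfHom_C]
    congr 2
    ring

/-! ### Symmetries of the Jones polynomial -/

theorem invert_negCube (n : ℤ) :
    LaurentPolynomial.invert (LinkDiagram.negCube n) = LinkDiagram.negCube (-n) := by
  simp only [LinkDiagram.negCube, map_mul, LaurentPolynomial.invert_C, LaurentPolynomial.invert_T,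
    Int.negOnePow_neg]
  congr 2
  ring

theorem linkWrithe_reverse (u : List LR) (s : Fin 3) (h : s ≠ 1) (h' : wordPerm u s ≠ 1) :
    linkWrithe u.reverse (wordPerm u s) = linkWrithe u s := by
  have key : ∀ t : Fin 3, t ≠ 1 → LR.L.sign t = LR.R.sign t := by decide
  rw [linkWrithe, linkWrithe, wordWrithe_reverse, wordPerm_reverse, key _ h, key _ h',
    ← Equiv.Perm.mul_apply, inv_mul_cancel, Equiv.Perm.one_apply]
  ring

theorem linkWrithe_map_swap (u : List LR) (s : Fin 3) (h : s ≠ 1) (h' : wordPerm u s ≠ 1) :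
    linkWrithe (u.map LR.swap) s.rev = -linkWrithe u s := by
  have key : ∀ t : Fin 3, t ≠ 1 → LR.L.sign t.rev = -LR.L.sign t ∧
      LR.R.sign t.rev = -LR.R.sign t := by decide
  rw [linkWrithe, linkWrithe, wordWrithe_map_swap, wordPerm_map_swap, Fin.rev_rev, (key _ h).1,
    (key _ h').2]
  ring

theorem wordPerm_reverse_apply_one (u : List LR) :
    wordPerm u.reverse 1 = 1 ↔ wordPerm u 1 = 1 := by
  rw [wordPerm_reverse, Equiv.Perm.inv_eq_iff_eq, eq_comm]

theorem wordPerm_map_swap_apply_one (u : List LR) :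
    wordPerm (u.map LR.swap) 1 = 1 ↔ wordPerm u 1 = 1 := by
  rw [wordPerm_map_swap, show Fin.rev (1 : Fin 3) = 1 from rfl, Fin.rev_eq_iff,
    show Fin.rev (1 : Fin 3) = 1 from rfl]

/-- If the denominator of `α` is odd, then `V(1 - α)` is the mirror image of `V(α)`. -/
theorem jonesV_map_swap_of_odd {w : List LR} (h : wordPerm w.reverse 1 ≠ 1) :
    jonesV (wordRat (w.map LR.swap)) = LaurentPolynomial.invert (jonesV (wordRat w)) := by
  obtain ⟨s, hs⟩ := exists_isStartType w.reverse
  have hs' : IsStartType (w.map LR.swap).reverse s.rev := by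
    rw [← List.map_reverse]
    refine ⟨fun h => hs.1 ?_, fun h => hs.2.1 ?_, fun h' => ?_⟩
    · rwa [Fin.rev_eq_iff] at h
    · rw [wordPerm_map_swap, Fin.rev_rev] at h
      rwa [Fin.rev_eq_iff] at h
    · exact absurd ((wordPerm_map_swap_apply_one _).mp h') h
  rw [jonesV_wordRat hs, jonesV_wordRat hs', ← List.map_reverse, wordBracket_map_swap,
    linkWrithe_map_swap _ _ hs.1 hs.2.1, map_mul, invert_negCube]

/-- If the denominator of `α` is odd, or if it and `x` are even, then reversing the word does not change the
Jones polynomial. -/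
theorem jonesV_reverse {w : List LR} (h : wordPerm w.reverse 1 ≠ 1 ∨ wordPerm w.reverse = 1) :
    jonesV (wordRat w.reverse) = jonesV (wordRat w) := by
  obtain ⟨s, hs⟩ := exists_isStartType w.reverse
  have hs' : IsStartType w.reverse.reverse (wordPerm w.reverse s) := by
    refine ⟨hs.2.1, ?_, fun h' => ?_⟩
    · rw [wordPerm_reverse w.reverse, ← Equiv.Perm.mul_apply, inv_mul_cancel,
        Equiv.Perm.one_apply]
      exact hs.1
    · rw [wordPerm_reverse_apply_one] at h'
      rcases h with h | h
      · exact absurd h' h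
      · rw [h, Equiv.Perm.one_apply]
        exact hs.2.2 h'
  rw [jonesV_wordRat hs, jonesV_wordRat hs', linkWrithe_reverse _ _ hs.1 hs.2.1,
    wordBracket_reverse]

/-- If the denominator of `α` and `y` are even, then the link of the reversed word, like the mirror image
of the link of `1 - α`, is the link of `α` with the orientation of one component reversed. -/
theorem jonesV_reverse_of_swap {w : List LR} (h1 : wordPerm w.reverse 1 = 1)
    (h2 : wordPerm w.reverse 0 = 2) :
    jonesV (wordRat w.reverse) =
      LaurentPolynomial.invert (jonesV (wordRat (w.map LR.swap))) := by
  have h3 : wordPerm w.reverse 2 = 0 := by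
    generalize wordPerm w.reverse = P at *
    revert P; decide
  have hs : IsStartType w.reverse.reverse 0 := by
    refine ⟨by decide, ?_, fun _ => rfl⟩
    rw [wordPerm_reverse w.reverse, Ne, Equiv.Perm.inv_eq_iff_eq, h1]
    decide
  have hs' : IsStartType (w.map LR.swap).reverse 0 := by
    refine ⟨by decide, ?_, fun _ => rfl⟩
    rw [← List.map_reverse, wordPerm_map_swap, show Fin.rev (0 : Fin 3) = 2 from rfl, h3]
    decide
  have hl := linkWrithe_reverse w.reverse 2 (by decide) (by rw [h3]; decide)
  have hl' := linkWrithe_map_swap w.reverse 2 (by decide) (by rw [h3]; decide)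
  rw [h3] at hl
  rw [show Fin.rev (2 : Fin 3) = 0 from rfl] at hl'
  rw [jonesV_wordRat hs, jonesV_wordRat hs', ← List.map_reverse, wordBracket_map_swap,
    hl', hl, map_mul, invert_negCube, wordBracket_reverse, neg_neg,
    LaurentPolynomial.involutive_invert (wordBracket w.reverse)]

/-! ### The class of a word -/

/-- The class of identified Jones polynomials, for the rational number with a given word. -/
noncomputable def wordClass (w : List LR) : Set ℤ[T;T⁻¹] :=
  jonesClass (wordRat w) (wordParents w).1 (wordParents w).2.2.1

/-- In terms of the permutation of the orientation types, the three cases of the definition of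
`jonesClass` are: the permutation moves `1`, is the identity, or is the transposition of `0`, `2`. -/
theorem mem_wordClass {w : List LR} {f : ℤ[T;T⁻¹]} : f ∈ wordClass w ↔
    (wordPerm w.reverse 1 ≠ 1 ∧
      (f = jonesV (wordRat w) ∨ f = LaurentPolynomial.invert (jonesV (wordRat w)))) ∨
    (wordPerm w.reverse = 1 ∧
      (f = jonesV (wordRat w) ∨ f = jonesV (wordRat (w.map LR.swap)))) ∨
    ((wordPerm w.reverse 1 = 1 ∧ wordPerm w.reverse 0 = 2) ∧
      (f = jonesV (wordRat w) ∨ f = jonesV (wordRat (w.map LR.swap)) ∨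
        f = LaurentPolynomial.invert (jonesV (wordRat (w.map LR.swap))) ∨
        f = LaurentPolynomial.invert (jonesV (wordRat w)))) := by
  obtain ⟨h1, -, h3, -⟩ := even_wordParents w
  have key1 : ∀ P : Equiv.Perm (Fin 3), (P 1 = 1 ∧ P 2 = 2) ↔ P = 1 := by decide
  have key2 : ∀ P : Equiv.Perm (Fin 3), (P 1 = 1 ∧ P 2 = 0) ↔ (P 1 = 1 ∧ P 0 = 2) := by decide
  rw [wordClass, jonesClass, Set.mem_ofPred_eq, ← Nat.not_even_iff_odd, even_den_wordRat, h1, h3,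
    wordRat_map_swap, ← and_assoc, key1, ← and_assoc, key2]

theorem or_permute {a b c d : Prop} : (b ∨ a ∨ d ∨ c) ↔ (a ∨ b ∨ c ∨ d) := by
  tauto

theorem wordClass_map_swap (w : List LR) : wordClass (w.map LR.swap) = wordClass w := by
  ext f
  have hP : ∀ t, wordPerm (w.map LR.swap).reverse t = (wordPerm w.reverse t.rev).rev := by
    intro t
    rw [← List.map_reverse, wordPerm_map_swap]
  have h1 : wordPerm (w.map LR.swap).reverse 1 = 1 ↔ wordPerm w.reverse 1 = 1 := by
    rw [← List.map_reverse, wordPerm_map_swap_apply_one]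
  have key : ∀ P Q : Equiv.Perm (Fin 3), (∀ t, Q t = (P t.rev).rev) →
      (Q = 1 ↔ P = 1) ∧ ((Q 1 = 1 ∧ Q 0 = 2) ↔ (P 1 = 1 ∧ P 0 = 2)) := by decide
  obtain ⟨h2, h3⟩ := key _ _ hP
  rw [mem_wordClass, mem_wordClass, h2, h3, Ne, h1, map_swap_map_swap]
  refine or_congr (and_congr_right fun h => ?_) (or_congr (and_congr_right fun h => ?_)
    (and_congr_right fun h => ?_))
  · rw [jonesV_map_swap_of_odd h,
      LaurentPolynomial.involutive_invert (jonesV (wordRat w))]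
    exact or_comm
  · exact or_comm
  · exact or_permute

theorem wordClass_reverse (w : List LR) : wordClass w.reverse = wordClass w := by
  ext f
  have key : ∀ P : Equiv.Perm (Fin 3), (P⁻¹ 1 = 1 ↔ P 1 = 1) ∧
      ((P⁻¹ 1 = 1 ∧ P⁻¹ 0 = 2) ↔ (P 1 = 1 ∧ P 0 = 2)) := by decide
  obtain ⟨h1, h3⟩ := key (wordPerm w.reverse)
  have hP : wordPerm w.reverse.reverse = (wordPerm w.reverse)⁻¹ := wordPerm_reverse _
  have hswap : (w.map LR.swap).reverse = w.reverse.map LR.swap := List.map_reverse.symm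
  rw [mem_wordClass, mem_wordClass, hP, h3, Ne, h1, inv_eq_one]
  refine or_congr (and_congr_right fun h => ?_) (or_congr (and_congr_right fun h => ?_)
    (and_congr_right fun h => ?_))
  · rw [jonesV_reverse (Or.inl h)]
  · have hs : wordPerm (w.map LR.swap).reverse = 1 := by
      ext t
      rw [hswap, wordPerm_map_swap, h]
      simp
    rw [jonesV_reverse (Or.inr h), ← hswap, jonesV_reverse (Or.inr hs)]
  · have hs1 : wordPerm (w.map LR.swap).reverse 1 = 1 := by
      rw [hswap, wordPerm_map_swap_apply_one]; exact h.1
    have hs2 : wordPerm (w.map LR.swap).reverse 0 = 2 := by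
      have : ∀ P : Equiv.Perm (Fin 3), P 1 = 1 ∧ P 0 = 2 → (P (Fin.rev 0)).rev = 2 := by decide
      rw [hswap, wordPerm_map_swap]; exact this _ h
    have e1 := jonesV_reverse_of_swap h.1 h.2
    have e2 := jonesV_reverse_of_swap hs1 hs2
    rw [map_swap_map_swap] at e2
    rw [← hswap, e1, e2, LaurentPolynomial.involutive_invert (jonesV (wordRat w)),
      LaurentPolynomial.involutive_invert (jonesV (wordRat (w.map LR.swap))), ← or_assoc, or_comm, or_assoc]

theorem WordRel.wordClass_eq {w w' : List LR} (h : WordRel w w') : wordClass w' = wordClass w := by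
  rcases h with rfl | rfl | rfl | rfl
  · rfl
  · exact wordClass_map_swap w
  · exact wordClass_reverse w
  · rw [wordClass_reverse, wordClass_map_swap]

theorem wordClass_subset_range (w : List LR) : wordClass w ⊆ Set.range substHalf := by
  intro f hf
  have h1 := jonesV_mem_range w
  have h2 := jonesV_mem_range (w.map LR.swap)
  rcases mem_wordClass.mp hf with ⟨-, h | h⟩ | ⟨-, h | h⟩ | ⟨-, h | h | h | h⟩ <;> rw [h]
  · exact h1
  · exact invert_mem_range h1
  · exact h1
  · exact h2
  · exact h1
  · exact h2
  · exact invert_mem_range h2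
  · exact invert_mem_range h1

theorem CCFrieze.isFriezeOf_wordRat {m : ℕ} {Γ : CCFrieze m} {w : List LR}
    (h : Γ.IsGeneratedBy w) : Γ.IsFriezeOf (wordRat w) :=
  ⟨Γ, w, isWord_wordRat w, h, 0, Or.inl fun i k _ => by rw [add_zero]⟩

/-- All rational numbers with the frieze `Γ` have the same class of Jones polynomials. -/
theorem CCFrieze.IsFriezeOf.jonesClass_eq {m : ℕ} {Γ : CCFrieze m} {w : List LR}
    (hw : Γ.IsGeneratedBy w) {α : ℚ} (hα : Γ.IsFriezeOf α) {x r y s : ℕ}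
    (hp : IsParents α x r y s) : jonesClass α x y = wordClass w := by
  obtain ⟨Γ', w', hw', hg, heq⟩ := hα
  obtain ⟨w'', hrel, hg'⟩ := hg.of_equivalent heq
  obtain rfl := hw'.eq_wordRat
  obtain ⟨rfl, -, rfl, -⟩ := (isParents_wordRat w').unique (wordRat_lt_one w') hp
  exact ((hw.wordRel hg').trans hrel.symm).wordClass_eq

theorem corollary4p8 {m : ℕ} (Γ : CCFrieze m) (hΓ : Γ.IsZigzagType) :
    (∃ α : ℚ, 0 < α ∧ α < 1 ∧ Γ.IsFriezeOf α) ∧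
    (∀ α : ℚ, 0 < α → α < 1 →
      ∃ x r y s : ℕ, IsParents α x r y s ∧
        (∀ x' r' y' s' : ℕ, IsParents α x' r' y' s' → x' = x ∧ r' = r ∧ y' = y ∧ s' = s) ∧
        (Even α.den → Xor (Even x) (Even y))) ∧
    (∃! V : Set ℤ[T;T⁻¹], ∀ α : ℚ, 0 < α → α < 1 → Γ.IsFriezeOf α →
      ∀ x r y s : ℕ, IsParents α x r y s → jonesClass α x y = substHalf '' V) := by
  obtain ⟨w, hw⟩ := hΓ
  refine ⟨⟨wordRat w, wordRat_pos w, wordRat_lt_one w, CCFrieze.isFriezeOf_wordRat hw⟩, ?_, ?_⟩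
  · intro α h0 h1
    obtain ⟨x, r, y, s, h⟩ := exists_isParents h0 h1
    exact ⟨x, r, y, s, h, fun x' r' y' s' h' => h.unique h1 h', h.xor_even⟩
  · obtain ⟨V, hV⟩ := Set.subset_range_iff_exists_image_eq.mp (wordClass_subset_range w)
    refine ⟨V, fun α _ _ hα x r y s hp => ?_, fun V' hV' => ?_⟩
    · rw [hα.jonesClass_eq hw hp, hV]
    · have h := hV' (wordRat w) (wordRat_pos w) (wordRat_lt_one w)
        (CCFrieze.isFriezeOf_wordRat hw) _ _ _ _ (isParents_wordRat w)
      apply substHalf_injective.image_injective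
      rw [hV]
      exact h.symm
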